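/- For nonnegative integers $d_1,d_2$ and a finite field $\mathbb F_q$ with $q$ elements, let $$\mathcal F_{(d_1,d_2)}=\{F=F_1F_2^2 : F_1,F_2\in\mathbb F_q[X]\text{ monic, square-free and coprime},\ \deg F_1=d_1,\ \deg F_2=d_2\}.$$ For every $\varepsilon>0$ there is a constant $C=C(\varepsilon)$, depending only on $\varepsilon$, such that the following holds. Let $q\equiv 1\pmod 3$, let $\chi_3$ be a multiplicative character of $\mathbb F_q$ of order $3$ (with $\chi_3(0)=0$), let $\omega\in\mathbb C$ be a primitive third root of unity, and put $S_3(F)=\sum_{x\in\mathbb F_q}\chi_3(F(x))$. Let $X_1,\dots,X_q$ be independent identically distributed complex random variables, each taking the value $0$ with probability $2/(q+2)$ and each of the values $1,\omega,\omega^2$ with probability $q/(3(q+2))$. Then for all integers $d_1,d_2\ge 0$ and every $s\in\mathbb Z[\omega]\subset\mathbb C$ there is a real number $\delta$ with $$\frac{\left|\{F\in\mathcal F_{(d_1,d_2)} : S_3(F)=s\}\right|}{\left|\mathcal F_{(d_1,d_2)}\right|}=\mathrm{Prob}\Big(\sum_{i=1}^q X_i=s\Big)\,(1+\delta),\qquad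 |\delta|\le C\left(q^{-(1-\varepsilon)d_2+q}+q^{-(d_1-3q)/2}\right).$$ -/

import Mathlib

open Polynomial MeasureTheory ProbabilityTheory

/-- The family of all `F = F₁ F₂²` with `F₁`, `F₂` monic, square-free and coprime of degrees
`d₁`, `d₂`. -/
def cubeFreeFamily (𝔽 : Type*) [Field 𝔽] (d₁ d₂ : ℕ) : Set 𝔽[X] :=
  {F | ∃ F₁ F₂ : 𝔽[X], F₁.Monic ∧ F₂.Monic ∧ Squarefree F₁ ∧ Squarefree F₂ ∧ IsCoprime F₁ F₂ ∧
    F₁.natDegree = d₁ ∧ F₂.natDegree = d₂ ∧ F = F₁ * F₂ ^ 2}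

/-- Over a finite field the family is finite, so `Set.ncard` is its cardinality. -/
theorem cubeFreeFamily_finite (𝔽 : Type*) [Field 𝔽] [Fintype 𝔽] (d₁ d₂ : ℕ) :
    (cubeFreeFamily 𝔽 d₁ d₂).Finite := by
  have hfin : Finite (degreeLT 𝔽 (d₁ + 2 * d₂ + 1)) :=
    Finite.of_equiv _ (degreeLTEquiv 𝔽 (d₁ + 2 * d₂ + 1)).symm.toEquiv
  refine Set.Finite.subset (s := (degreeLT 𝔽 (d₁ + 2 * d₂ + 1) : Set 𝔽[X])) (Set.toFinite _) ?_
  rintro F ⟨F₁, F₂, h₁, h₂, -, -, -, hd₁, hd₂, rfl⟩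
  rw [SetLike.mem_coe, mem_degreeLT, degree_eq_natDegree (h₁.mul (h₂.pow 2)).ne_zero,
    h₁.natDegree_mul (h₂.pow 2), h₂.natDegree_pow, hd₁, hd₂]
  exact_mod_cast Nat.lt_succ_self _

/-- The affine character sum `∑ χ(F(x))` over all `x` in the finite field. -/
noncomputable def affineCharSum {𝔽 : Type*} [Field 𝔽] [Fintype 𝔽] (χ : MulChar 𝔽 ℂ)
    (F : 𝔽[X]) : ℂ :=
  ∑ x : 𝔽, χ (F.eval x)

set_option linter.unusedSectionVars false

/-! ### Monic polynomials, sets of primes, and the exact count of square-free polynomials. -/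

section MonicPolynomials

open scoped Classical

variable (𝔽 : Type*) [Field 𝔽] [Fintype 𝔽]

/-! Write F = F₁F₂². By unique factorisation F is a pair of disjoint finite sets of monic
irreducibles ("primes") of total degrees d₁ and d₂, so everything is a count of such pairs. It is
enough to show, for each vector a of values in {0, 1, ω, ω²}, that the number of pairs with χ(F(x))
= a(x) for all x is W · ∏ₓ Prob(Xᵢ = a(x)) up to a relative error η, with W and η independent of a.
Summing over the a with total s, and over all a, and dividing, cancels W.

To count for one a, let Z be its zero set and choose the set A ⊆ Z of roots of F₁; those of F₂ are
then Z \ A. This choice has 2^|Z| possibilities, which is why the model gives 0 the numerator 2.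
Split off the linear factors. With the root-free part of F₂ fixed, the root-free part of F₁ must be
square-free, coprime to it, and take nonzero values b(x), with χ(b(x)) prescribed exactly where a(x)
≠ 0. That allows (q-1)^|Z| ((q-1)/3)^(q-|Z|) vectors b, a number that depends neither on A nor on F₂
(`card_residues`).

For one b, inclusion-exclusion over primes of degree at least 2 reduces to monic polynomials with
all values prescribed: exactly q^(j-q) of them in degree j ≥ q and at most one below. The main terms
multiply to a product over primes, and the errors add up to O(q^(n/2)) times a divisor sum over F₂
(`abs_card_classSubsets_sub_le`), which is bounded on average (`sum_sum_powerset_zpow_neg_le`). This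
is the source of q^(-(d₁-3q)/2).

It remains to average ∏ 1/(1+|P|⁻¹) over the root-free square-free F₂. Start from the exact count of
all square-free polynomials and change the weight of one prime at a time. Each change multiplies the
generating function by (1+βvᵖ)/(1+vᵖ), whose effect on main term and error is controlled by
`abs_sub_le_of_add_shift_eq`. With r = q^(-ε) the accumulated loss is (1-r)^(-q) e^((1-r)^(-2)),
mostly from the q linear primes (`abs_sum_prod_coprimeDensity_sub_le`). It gives q^(-(1-ε)d₂+q),
since r^q absorbs (1-r)^(-q) for all but finitely many q.

Only primes of degree at most some K ≥ d₁, d₂ occur. Hence all Euler products are finite, and their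
dependence on K sits in W and cancels. Because η need not be small, the division uses a direct lower
bound for the size of the family (`fifth_le_card_primePairs`) rather than the asymptotic formula. -/

theorem finite_monic_natDegree (n : ℕ) : {p : 𝔽[X] | p.Monic ∧ p.natDegree = n}.Finite := by
  have : Finite (degreeLT 𝔽 n) := Finite.of_equiv _ (degreeLTEquiv 𝔽 n).symm.toEquiv
  exact Set.finite_coe_iff.mp (Finite.of_equiv _ (monicEquivDegreeLT (R := 𝔽) n).symm)

/-- The monic polynomials of degree `n`. -/
noncomputable def monics (n : ℕ) : Finset 𝔽[X] := (finite_monic_natDegree 𝔽 n).toFinset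

variable {𝔽}

@[simp]
theorem mem_monics {n : ℕ} {p : 𝔽[X]} : p ∈ monics 𝔽 n ↔ p.Monic ∧ p.natDegree = n := by
  simp [monics]

theorem card_monics (n : ℕ) : (monics 𝔽 n).card = Fintype.card 𝔽 ^ n := by
  have h : Nat.card {p : 𝔽[X] // p.Monic ∧ p.natDegree = n} = Fintype.card 𝔽 ^ n := by
    rw [Nat.card_congr ((monicEquivDegreeLT n).trans (degreeLTEquiv 𝔽 n).toEquiv)]
    simp
  rw [← h, monics, ← Set.ncard_eq_toFinset_card _ (finite_monic_natDegree 𝔽 n)]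
  rfl

variable (𝔽) in
/-- The monic irreducible polynomials of degree at most `K`. -/
noncomputable def irreds (K : ℕ) : Finset 𝔽[X] :=
  ((Finset.range (K + 1)).biUnion (monics 𝔽)).filter Irreducible

@[simp]
theorem mem_irreds {K : ℕ} {p : 𝔽[X]} :
    p ∈ irreds 𝔽 K ↔ p.Monic ∧ p.natDegree ≤ K ∧ Irreducible p := by
  simp [irreds]
  tauto

/-- The degree of the product of a finite set of polynomials. -/
noncomputable def degs (S : Finset 𝔽[X]) : ℕ := ∑ P ∈ S, P.natDegree

theorem degs_union {S T : Finset 𝔽[X]} (h : Disjoint S T) : degs (S ∪ T) = degs S + degs T :=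
  Finset.sum_union h

theorem monic_prod_finset {S : Finset 𝔽[X]} (h : ∀ P ∈ S, P.Monic) : (∏ P ∈ S, P).Monic :=
  monic_prod_of_monic _ _ h

theorem natDegree_prod_finset {S : Finset 𝔽[X]} (h : ∀ P ∈ S, P.Monic) :
    (∏ P ∈ S, P).natDegree = degs S :=
  natDegree_prod_of_monic _ _ h

theorem eq_of_monic_irreducible_dvd {P Q : 𝔽[X]} (hP : P.Monic) (hQ : Q.Monic)
    (hPi : Irreducible P) (hQi : Irreducible Q) (h : P ∣ Q) : P = Q :=
  eq_of_monic_of_associated hP hQ (hPi.associated_of_dvd hQi h)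

theorem isCoprime_of_monic_irreducible_ne {P Q : 𝔽[X]} (hP : P.Monic) (hQ : Q.Monic)
    (hPi : Irreducible P) (hQi : Irreducible Q) (h : P ≠ Q) : IsCoprime P Q := by
  rw [hPi.coprime_iff_not_dvd]
  exact fun hd => h (eq_of_monic_irreducible_dvd hP hQ hPi hQi hd)

/-- A finite set of monic irreducible polynomials. -/
def IsPrimeSet (S : Finset 𝔽[X]) : Prop := ∀ P ∈ S, P.Monic ∧ Irreducible P

theorem IsPrimeSet.mono {S T : Finset 𝔽[X]} (hT : IsPrimeSet T) (h : S ⊆ T) : IsPrimeSet S :=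
  fun P hP => hT P (h hP)

theorem isPrimeSet_irreds (K : ℕ) : IsPrimeSet (irreds 𝔽 K) := fun P hP => by
  rw [mem_irreds] at hP; exact ⟨hP.1, hP.2.2⟩

theorem IsPrimeSet.natDegree_pos {S : Finset 𝔽[X]} (hS : IsPrimeSet S) {P : 𝔽[X]} (hP : P ∈ S) :
    0 < P.natDegree := (hS P hP).2.natDegree_pos

theorem IsPrimeSet.monic_prod {S : Finset 𝔽[X]} (hS : IsPrimeSet S) : (∏ P ∈ S, P).Monic :=
  monic_prod_finset fun P hP => (hS P hP).1

theorem IsPrimeSet.natDegree_prod {S : Finset 𝔽[X]} (hS : IsPrimeSet S) :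
    (∏ P ∈ S, P).natDegree = degs S :=
  natDegree_prod_finset fun P hP => (hS P hP).1

theorem IsPrimeSet.pairwise_isCoprime {S : Finset 𝔽[X]} (hS : IsPrimeSet S) :
    (S : Set 𝔽[X]).Pairwise (IsCoprime) := fun P hP Q hQ h =>
  isCoprime_of_monic_irreducible_ne (hS P hP).1 (hS Q hQ).1 (hS P hP).2 (hS Q hQ).2 h

theorem IsPrimeSet.squarefree_prod {S : Finset 𝔽[X]} (hS : IsPrimeSet S) :
    Squarefree (∏ P ∈ S, P) :=
  Finset.squarefree_prod_of_pairwise_isCoprime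
    (fun _ hP _ hQ h => (hS.pairwise_isCoprime hP hQ h).isRelPrime)
    fun P hP => (hS P hP).2.squarefree

theorem IsPrimeSet.dvd_prod_iff {S : Finset 𝔽[X]} (hS : IsPrimeSet S) {P : 𝔽[X]} (hP : P.Monic)
    (hPi : Irreducible P) : P ∣ ∏ Q ∈ S, Q ↔ P ∈ S := by
  refine ⟨fun h => ?_, fun h => Finset.dvd_prod_of_mem _ h⟩
  obtain ⟨Q, hQ, hd⟩ := (hPi.prime.dvd_finsetProd_iff _).1 h
  rwa [eq_of_monic_irreducible_dvd hP (hS Q hQ).1 hPi (hS Q hQ).2 hd]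

theorem IsPrimeSet.prod_injOn {S T : Finset 𝔽[X]} (hS : IsPrimeSet S) (hT : IsPrimeSet T)
    (h : ∏ P ∈ S, P = ∏ P ∈ T, P) : S = T := by
  ext P
  constructor
  · intro hP
    have := hS P hP
    rw [← hT.dvd_prod_iff this.1 this.2, ← h]
    exact Finset.dvd_prod_of_mem _ hP
  · intro hP
    have := hT P hP
    rw [← hS.dvd_prod_iff this.1 this.2, h]
    exact Finset.dvd_prod_of_mem _ hP

theorem exists_irreds_prod_eq {K : ℕ} {F : 𝔽[X]} (hF : F.Monic) (hsq : Squarefree F)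
    (hK : F.natDegree ≤ K) :
    (irreds 𝔽 K).filter (· ∣ F) ⊆ irreds 𝔽 K ∧ ∏ P ∈ (irreds 𝔽 K).filter (· ∣ F), P = F := by
  refine ⟨Finset.filter_subset _ _, ?_⟩
  have hS : IsPrimeSet ((irreds 𝔽 K).filter (· ∣ F)) :=
    (isPrimeSet_irreds K).mono (Finset.filter_subset _ _)
  obtain ⟨E, hE⟩ : ∏ P ∈ (irreds 𝔽 K).filter (· ∣ F), P ∣ F :=
    Finset.prod_dvd_of_coprime hS.pairwise_isCoprime fun P hP => (Finset.mem_filter.1 hP).2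
  have hEm : E.Monic := hS.monic_prod.of_mul_monic_left (hE ▸ hF)
  by_cases hu : IsUnit E
  · rw [hEm.eq_one_of_isUnit hu, mul_one] at hE
    exact hE.symm
  · exfalso
    obtain ⟨P, hPm, hPi, hPE⟩ := exists_monic_irreducible_factor E hu
    have hPF : P ∣ F := hPE.trans ⟨_, hE.trans (mul_comm _ _)⟩
    have hmem : P ∈ (irreds 𝔽 K).filter (· ∣ F) := by
      rw [Finset.mem_filter, mem_irreds]
      exact ⟨⟨hPm, (natDegree_le_of_dvd hPF hF.ne_zero).trans hK, hPi⟩, hPF⟩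
    refine hPi.not_isUnit (hsq P ?_)
    rw [hE]
    exact mul_dvd_mul (Finset.dvd_prod_of_mem _ hmem) hPE

/-- The subsets of a finite set of polynomials whose product has degree `k`. -/
noncomputable def subsetsOfDeg (S : Finset 𝔽[X]) (k : ℤ) : Finset (Finset 𝔽[X]) :=
  S.powerset.filter fun T => (degs T : ℤ) = k

@[simp]
theorem mem_subsetsOfDeg {S T : Finset 𝔽[X]} {k : ℤ} :
    T ∈ subsetsOfDeg S k ↔ T ⊆ S ∧ (degs T : ℤ) = k := by
  simp [subsetsOfDeg]

/-- A set of primes is determined by its product, a monic polynomial of degree k. This crude count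
is used in all error sums. The degree is an integer so that subtractions of degrees never truncate.
-/
theorem card_subsetsOfDeg_le {S : Finset 𝔽[X]} (hS : IsPrimeSet S) (k : ℤ) :
    ((subsetsOfDeg S k).card : ℝ) ≤ (Fintype.card 𝔽 : ℝ) ^ k := by
  rcases lt_or_ge k 0 with hk | hk
  · have : subsetsOfDeg S k = ∅ := by
      ext T; simp; intro _; omega
    rw [this]; simp; positivity
  · lift k to ℕ using hk
    have : (subsetsOfDeg S k).card ≤ (monics 𝔽 k).card := by
      refine Finset.card_le_card_of_injOn (fun T => ∏ P ∈ T, P) ?_ ?_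
      · intro T hT
        simp only [Finset.mem_coe, mem_subsetsOfDeg, Nat.cast_inj] at hT
        simp [(hS.mono hT.1).monic_prod, (hS.mono hT.1).natDegree_prod, hT.2]
      · intro T hT U hU h
        simp only [Finset.mem_coe, mem_subsetsOfDeg] at hT hU
        exact (hS.mono hT.1).prod_injOn (hS.mono hU.1) h
    rw [card_monics] at this
    exact_mod_cast this

theorem exists_mul_self_mul_squarefree {M : 𝔽[X]} (hM : M.Monic) :
    ∃ D Q : 𝔽[X], D.Monic ∧ Q.Monic ∧ Squarefree Q ∧ D * D * Q = M := by
  induction h : M.natDegree using Nat.strong_induction_on generalizing M with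
  | _ n ih =>
    by_cases hs : Squarefree M
    · exact ⟨1, M, monic_one, hM, hs, by simp⟩
    · rw [squarefree_iff_irreducible_sq_not_dvd_of_ne_zero hM.ne_zero] at hs
      push Not at hs
      obtain ⟨P₀, hPi₀, hPd₀⟩ := hs
      obtain ⟨P, hPm, hPi, hPP⟩ := exists_monic_irreducible_factor P₀ hPi₀.not_isUnit
      obtain ⟨E, hE⟩ := (mul_dvd_mul hPP hPP).trans hPd₀
      have hEm : E.Monic := (hPm.mul hPm).of_mul_monic_left (hE ▸ hM)
      have hdeg := congrArg natDegree hE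
      rw [(hPm.mul hPm).natDegree_mul hEm, hPm.natDegree_mul hPm] at hdeg
      have hpos := hPi.natDegree_pos
      obtain ⟨D, Q, hD, hQ, hQs, hDQ⟩ := ih E.natDegree (by omega) hEm rfl
      exact ⟨P * D, Q, hPm.mul hD, hQ, hQs, by rw [hE, ← hDQ]; ring⟩

/-- Divide D and D' by their gcd to get coprime a and b with a²Q = b²Q'. Then a² divides the
square-free Q', so a is a unit and D divides D'; conclude by symmetry. -/
theorem eq_of_mul_self_mul_squarefree {D Q D' Q' : 𝔽[X]} (hD : D.Monic) (hD' : D'.Monic)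
    (hQ : Squarefree Q) (hQ' : Squarefree Q') (h : D * D * Q = D' * D' * Q') : D = D' := by
  have key : ∀ {D Q D' Q' : 𝔽[X]}, D ≠ 0 → Squarefree Q' → D * D * Q = D' * D' * Q' → D ∣ D' := by
    intro D Q D' Q' hD hQ' h
    have hg : EuclideanDomain.gcd D D' ≠ 0 := fun h0 => hD (EuclideanDomain.gcd_eq_zero_iff.1 h0).1
    obtain ⟨a, ha⟩ := EuclideanDomain.gcd_dvd_left D D'
    obtain ⟨b, hb⟩ := EuclideanDomain.gcd_dvd_right D D'
    have hbez := EuclideanDomain.gcd_eq_gcd_ab D D'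
    set g := EuclideanDomain.gcd D D'
    set u := EuclideanDomain.gcdA D D'
    set v := EuclideanDomain.gcdB D D'
    have hab : IsCoprime a b := by
      refine ⟨u, v, mul_left_cancel₀ hg ?_⟩
      calc g * (u * a + v * b) = (g * a) * u + (g * b) * v := by ring
        _ = g * 1 := by rw [← ha, ← hb, ← hbez, mul_one]
    have h2 : a * a * Q = b * b * Q' := by
      have : (g * g) * (a * a * Q) = (g * g) * (b * b * Q') := by
        calc _ = (g * a) * (g * a) * Q := by ring
          _ = (g * b) * (g * b) * Q' := by rw [← ha, ← hb]; exact h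
          _ = _ := by ring
      exact mul_left_cancel₀ (mul_ne_zero hg hg) this
    have h3 : a * a ∣ Q' := by
      have : IsCoprime (a * a) (b * b) :=
        IsCoprime.mul_left (hab.mul_right hab) (hab.mul_right hab)
      exact this.dvd_of_dvd_mul_left ⟨Q, h2.symm⟩
    have h4 : IsUnit a := hQ' a h3
    rw [ha, hb]
    exact mul_dvd_mul_left g (h4.dvd)
  exact eq_of_monic_of_associated hD hD' (associated_of_dvd_dvd
    (key hD.ne_zero hQ' h) (key hD'.ne_zero hQ h.symm))

variable (𝔽) in
/-- The monic square-free polynomials of degree `n`. -/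
noncomputable def sqfreeMonics (n : ℕ) : Finset 𝔽[X] := (monics 𝔽 n).filter Squarefree

/-- Every monic polynomial is D²Q with D monic and Q monic square-free in a unique way; sort by d =
deg D. -/
theorem sum_card_sqfreeMonics (n : ℕ) :
    ∑ d ∈ Finset.range (n / 2 + 1), Fintype.card 𝔽 ^ d * (sqfreeMonics 𝔽 (n - 2 * d)).card =
      Fintype.card 𝔽 ^ n := by
  rw [← card_monics n]
  simp_rw [← card_monics, ← Finset.card_product]
  rw [← Finset.card_sigma]
  refine Finset.card_bij (fun x _ => x.2.1 * x.2.1 * x.2.2) ?_ ?_ ?_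
  · rintro ⟨d, D, Q⟩ h
    simp only [Finset.mem_sigma, Finset.mem_range, Finset.mem_product, mem_monics, sqfreeMonics,
      Finset.mem_filter] at h ⊢
    obtain ⟨h1, ⟨h2, h3⟩, ⟨h4, h5⟩, h6⟩ := h
    refine ⟨(h2.mul h2).mul h4, ?_⟩
    rw [(h2.mul h2).natDegree_mul h4, h2.natDegree_mul h2]
    omega
  · rintro ⟨d, D, Q⟩ h ⟨d', D', Q'⟩ h' he
    simp only [Finset.mem_sigma, Finset.mem_range, Finset.mem_product, mem_monics, sqfreeMonics,
      Finset.mem_filter] at h h' he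
    obtain ⟨h1, ⟨h2, h3⟩, ⟨h4, h5⟩, h6⟩ := h
    obtain ⟨h1', ⟨h2', h3'⟩, ⟨h4', h5'⟩, h6'⟩ := h'
    have hD := eq_of_mul_self_mul_squarefree h2 h2' h6 h6' he
    subst hD
    have hQ := mul_left_cancel₀ (mul_ne_zero h2.ne_zero h2.ne_zero) he
    subst hQ
    rw [← h3, ← h3']
  · intro M hM
    rw [mem_monics] at hM
    obtain ⟨D, Q, hD, hQ, hQs, hDQ⟩ := exists_mul_self_mul_squarefree hM.1
    have hdeg := congrArg natDegree hDQ
    rw [(hD.mul hD).natDegree_mul hQ, hD.natDegree_mul hD, hM.2] at hdeg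
    refine ⟨⟨D.natDegree, D, Q⟩, ?_, hDQ⟩
    simp only [Finset.mem_sigma, Finset.mem_range, Finset.mem_product, mem_monics, sqfreeMonics,
      Finset.mem_filter]
    exact ⟨by omega, ⟨hD, trivial⟩, ⟨hQ, by omega⟩, hQs⟩

/-- Subtract q times the identity of `sum_card_sqfreeMonics` for n from the one for n + 2: only the
term d = 0 survives. -/
theorem card_sqfreeMonics_add_two (n : ℕ) :
    (sqfreeMonics 𝔽 (n + 2)).card + Fintype.card 𝔽 ^ (n + 1) = Fintype.card 𝔽 ^ (n + 2) := by
  rw [← sum_card_sqfreeMonics (n + 2), show (n + 2) / 2 + 1 = (n / 2 + 1) + 1 by omega,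
    Finset.sum_range_succ', add_comm, pow_succ', ← sum_card_sqfreeMonics n, Finset.mul_sum]
  congr 1
  · refine Finset.sum_congr rfl fun d _ => ?_
    rw [show n + 2 - 2 * (d + 1) = n - 2 * d by omega]
    ring
  · simp

theorem card_sqfreeMonics_of_lt_two {n : ℕ} (hn : n < 2) :
    (sqfreeMonics 𝔽 n).card = Fintype.card 𝔽 ^ n := by
  rw [← sum_card_sqfreeMonics n, show n / 2 + 1 = 1 by omega]
  simp

theorem card_subsetsOfDeg_irreds {K n : ℕ} (hn : n ≤ K) :
    (subsetsOfDeg (irreds 𝔽 K) n).card = (sqfreeMonics 𝔽 n).card := by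
  refine Finset.card_bij (fun T _ => ∏ P ∈ T, P) ?_ ?_ ?_
  · intro T hT
    simp only [mem_subsetsOfDeg, Nat.cast_inj] at hT
    have := (isPrimeSet_irreds K).mono hT.1
    simp [sqfreeMonics, this.monic_prod, this.natDegree_prod, hT.2, this.squarefree_prod]
  · intro T hT U hU h
    simp only [mem_subsetsOfDeg] at hT hU
    exact ((isPrimeSet_irreds K).mono hT.1).prod_injOn ((isPrimeSet_irreds K).mono hU.1) h
  · intro F hF
    simp only [sqfreeMonics, Finset.mem_filter, mem_monics] at hF
    obtain ⟨h1, h2⟩ := exists_irreds_prod_eq (K := K) hF.1.1 hF.2 (by omega)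
    refine ⟨_, ?_, h2⟩
    simp only [mem_subsetsOfDeg, h1, true_and, Nat.cast_inj]
    rw [← ((isPrimeSet_irreds K).mono h1).natDegree_prod, h2, hF.1.2]

end MonicPolynomials

/-! ### Polynomials with all values prescribed, and the sieve for square-free ones. -/

section ValueClasses

open scoped Classical

variable {𝔽 : Type*} [Field 𝔽] [Fintype 𝔽]

/-- The monic polynomials of degree `j` taking the values prescribed by `b`; there are none if
`j < 0`. -/
noncomputable def monicClass (j : ℤ) (b : 𝔽 → 𝔽) : Finset 𝔽[X] :=
  (monics 𝔽 j.toNat).filter fun M => (M.natDegree : ℤ) = j ∧ ∀ x, M.eval x = b x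

@[simp]
theorem mem_monicClass {j : ℤ} {b : 𝔽 → 𝔽} {M : 𝔽[X]} :
    M ∈ monicClass j b ↔ M.Monic ∧ (M.natDegree : ℤ) = j ∧ ∀ x, M.eval x = b x := by
  simp only [monicClass, Finset.mem_filter, mem_monics]
  constructor
  · rintro ⟨⟨h1, -⟩, h2⟩; exact ⟨h1, h2⟩
  · rintro ⟨h1, h2, h3⟩; exact ⟨⟨h1, by omega⟩, h2, h3⟩

theorem monicClass_eq_empty {j : ℤ} (hj : j < 0) (b : 𝔽 → 𝔽) : monicClass j b = ∅ := by
  ext M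
  simp only [mem_monicClass, Finset.notMem_empty, iff_false]
  rintro ⟨-, h, -⟩
  omega

theorem card_monicClass_le_one {j : ℤ} (hj : j < Fintype.card 𝔽) (b : 𝔽 → 𝔽) :
    (monicClass j b).card ≤ 1 := by
  rw [Finset.card_le_one]
  intro M hM M' hM'
  rw [mem_monicClass] at hM hM'
  refine eq_of_degree_sub_lt_of_eval_finset_eq Finset.univ ?_ fun x _ => by
    rw [hM.2.2, hM'.2.2]
  refine (degree_sub_le _ _).trans_lt (max_lt ?_ ?_)
  · rw [degree_eq_natDegree hM.1.ne_zero, Finset.card_univ]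
    exact_mod_cast (by omega : M.natDegree < Fintype.card 𝔽)
  · rw [degree_eq_natDegree hM'.1.ne_zero, Finset.card_univ]
    exact_mod_cast (by omega : M'.natDegree < Fintype.card 𝔽)

/-- Such polynomials are N·G + L with N = ∏ (X - x), L the Lagrange interpolant of b and G any monic
polynomial of degree m. -/
theorem card_monicClass_add (m : ℕ) (b : 𝔽 → 𝔽) :
    (monicClass ((m : ℤ) + Fintype.card 𝔽) b).card = Fintype.card 𝔽 ^ m := by
  rw [← card_monics m]
  symm
  set N : 𝔽[X] := Lagrange.nodal Finset.univ id with hN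
  have hNm : N.Monic := Lagrange.nodal_monic
  have hNd : N.natDegree = Fintype.card 𝔽 := Lagrange.natDegree_nodal
  have hNe : ∀ x, N.eval x = 0 := fun x =>
    Lagrange.eval_nodal_at_node (v := id) (Finset.mem_univ x)
  have hinj : Set.InjOn (id : 𝔽 → 𝔽) (Finset.univ : Finset 𝔽) := Function.injective_id.injOn
  set L : 𝔽[X] := Lagrange.interpolate Finset.univ id b with hL
  have hLe : ∀ x, L.eval x = b x := fun x =>
    Lagrange.eval_interpolate_at_node b hinj (Finset.mem_univ x)
  have hLd : L.degree < N.degree := by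
    rw [hN, Lagrange.degree_nodal]
    exact Lagrange.degree_interpolate_lt b hinj
  refine Finset.card_bij (fun G _ => N * G + L) ?_ ?_ ?_
  · intro G hG
    rw [mem_monics] at hG
    have hNG : (N * G).Monic := hNm.mul hG.1
    have hlt : L.degree < (N * G).degree := by
      rw [degree_mul]
      refine hLd.trans_le ?_
      rw [degree_eq_natDegree hNm.ne_zero, degree_eq_natDegree hG.1.ne_zero]
      exact_mod_cast Nat.le_add_right _ _
    rw [mem_monicClass]
    refine ⟨hNG.add_of_left hlt, ?_, fun x => by simp [hNe, hLe]⟩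
    rw [natDegree_add_eq_left_of_degree_lt hlt, hNm.natDegree_mul hG.1, hNd, hG.2]
    push_cast; ring
  · intro G _ G' _ h
    exact mul_left_cancel₀ hNm.ne_zero (add_right_cancel h)
  · intro M hM
    rw [mem_monicClass] at hM
    obtain ⟨hMm, hMd, hMe⟩ := hM
    have hMd' : M.natDegree = m + Fintype.card 𝔽 := by exact_mod_cast hMd
    have hlt : L.degree < M.degree := by
      refine hLd.trans_le ?_
      rw [degree_eq_natDegree hNm.ne_zero, degree_eq_natDegree hMm.ne_zero, hMd', hNd]
      exact_mod_cast Nat.le_add_left _ _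
    have hdvd : N ∣ M - L := by
      rw [hN, Lagrange.nodal_eq]
      refine Finset.prod_dvd_of_coprime (fun x _ y _ hxy => ?_) fun x _ => ?_
      · exact isCoprime_X_sub_C_of_isUnit_sub (sub_ne_zero.2 hxy).isUnit
      · rw [dvd_iff_isRoot]
        simp [IsRoot, hMe, hLe]
    obtain ⟨G, hG⟩ := hdvd
    have hMLm : (M - L).Monic := hMm.sub_of_left hlt
    have hGm : G.Monic := hNm.of_mul_monic_left (hG ▸ hMLm)
    refine ⟨G, ?_, by rw [← hG]; ring⟩
    rw [mem_monics]
    refine ⟨hGm, ?_⟩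
    have := congrArg natDegree hG
    rw [hNm.natDegree_mul hGm, natDegree_eq_of_degree_eq (degree_sub_eq_left_of_degree_lt hlt),
      hMd', hNd] at this
    omega

/-- The bound is 1 for j ≥ 0 and q^j for j < 0. Negative degrees are kept so that the main term
q^(j-q) can be summed over every set of primes in the sieve, giving a full Euler product with no
truncation. -/
theorem abs_card_monicClass_sub_le {t : ℝ} (htq : t ^ 2 = Fintype.card 𝔽) (j : ℤ)
    (b : 𝔽 → 𝔽) :
    |((monicClass j b).card : ℝ) - (Fintype.card 𝔽 : ℝ) ^ (j - (Fintype.card 𝔽 : ℤ))| ≤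
      t ^ (j - |j|) := by
  have hq1 : (1 : ℝ) ≤ Fintype.card 𝔽 := by exact_mod_cast Fintype.card_pos
  have hpos : 0 ≤ (Fintype.card 𝔽 : ℝ) ^ (j - (Fintype.card 𝔽 : ℤ)) := by positivity
  rcases lt_or_ge j 0 with hj | hj
  · rw [monicClass_eq_empty hj, Finset.card_empty, Nat.cast_zero, zero_sub, abs_neg,
      abs_of_nonneg hpos, abs_of_neg hj, show j - -j = 2 * j by ring, zpow_mul]
    rw [show t ^ (2 : ℤ) = Fintype.card 𝔽 by exact_mod_cast htq]
    exact zpow_le_zpow_right₀ hq1 (by omega)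
  · rw [abs_of_nonneg hj, sub_self, zpow_zero]
    rcases lt_or_ge j (Fintype.card 𝔽 : ℤ) with hjq | hjq
    · have h1 : ((monicClass j b).card : ℝ) ≤ 1 := by exact_mod_cast card_monicClass_le_one hjq b
      have h2 : (Fintype.card 𝔽 : ℝ) ^ (j - (Fintype.card 𝔽 : ℤ)) ≤ 1 :=
        zpow_le_one_of_nonpos₀ hq1 (by omega)
      rw [abs_le]
      constructor <;> linarith [Nat.cast_nonneg (α := ℝ) (monicClass j b).card]
    · obtain ⟨m, hm⟩ := Int.eq_ofNat_of_zero_le (sub_nonneg.2 hjq)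
      have hj' : j = m + Fintype.card 𝔽 := by omega
      rw [hm, hj', card_monicClass_add]
      simp

/-- Dividing by a polynomial without roots keeps the problem of the same kind: the degree drops by
deg h and the values are divided by those of h. -/
theorem card_filter_dvd_monicClass {h : 𝔽[X]} (hm : h.Monic) (h0 : ∀ x, h.eval x ≠ 0) (j : ℤ)
    (b : 𝔽 → 𝔽) :
    ((monicClass j b).filter (h ∣ ·)).card =
      (monicClass (j - h.natDegree) fun x => b x / h.eval x).card := by
  symm
  refine Finset.card_bij (fun M _ => h * M) ?_ ?_ ?_
  · intro M hM
    rw [mem_monicClass] at hM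
    rw [Finset.mem_filter, mem_monicClass]
    refine ⟨⟨hm.mul hM.1, ?_, fun x => ?_⟩, dvd_mul_right _ _⟩
    · rw [hm.natDegree_mul hM.1]; push_cast; rw [hM.2.1]; ring
    · rw [eval_mul, hM.2.2]; field_simp [h0 x]
  · intro M _ M' _ he
    exact mul_left_cancel₀ hm.ne_zero he
  · intro M hM
    rw [Finset.mem_filter, mem_monicClass] at hM
    obtain ⟨⟨h1, h2, h3⟩, G, rfl⟩ := hM
    have hG : G.Monic := hm.of_mul_monic_left h1
    refine ⟨G, ?_, rfl⟩
    rw [mem_monicClass]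
    refine ⟨hG, ?_, fun x => ?_⟩
    · rw [hm.natDegree_mul hG] at h2; push_cast at h2; rw [← h2]; ring
    · rw [← h3, eval_mul]; field_simp [h0 x]

variable (𝔽) in
/-- The monic irreducible polynomials of degree at least `2` and at most `K`. -/
noncomputable def nonlinIrreds (K : ℕ) : Finset 𝔽[X] := (irreds 𝔽 K).filter (2 ≤ ·.natDegree)

theorem nonlinIrreds_subset (K : ℕ) : nonlinIrreds 𝔽 K ⊆ irreds 𝔽 K := Finset.filter_subset _ _

theorem isPrimeSet_nonlinIrreds (K : ℕ) : IsPrimeSet (nonlinIrreds 𝔽 K) :=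
  (isPrimeSet_irreds K).mono (nonlinIrreds_subset K)

theorem eval_ne_zero_of_mem_nonlinIrreds {K : ℕ} {P : 𝔽[X]} (hP : P ∈ nonlinIrreds 𝔽 K) (x : 𝔽) :
    P.eval x ≠ 0 := by
  rw [nonlinIrreds, Finset.mem_filter, mem_irreds] at hP
  intro h
  have := degree_eq_one_of_irreducible_of_root hP.1.2.2 h
  have h1 : P.natDegree = 1 := natDegree_eq_of_degree_eq_some this
  omega

theorem mem_nonlinIrreds_of_dvd {K : ℕ} {P M : 𝔽[X]} (hP : P.Monic) (hPi : Irreducible P)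
    (hM : M ≠ 0) (hMK : M.natDegree ≤ K) (h0 : ∀ x, M.eval x ≠ 0) (h : P ∣ M) :
    P ∈ nonlinIrreds 𝔽 K := by
  rw [nonlinIrreds, Finset.mem_filter, mem_irreds]
  refine ⟨⟨hP, (natDegree_le_of_dvd h hM).trans hMK, hPi⟩, ?_⟩
  by_contra hlt
  have h1 : P.natDegree = 1 := by have := hPi.natDegree_pos; omega
  obtain ⟨x, hx⟩ := exists_root_of_degree_eq_one
    (by rw [degree_eq_natDegree hP.ne_zero, h1]; rfl)
  exact h0 x (eval_eq_zero_of_dvd_of_eval_eq_zero h hx)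

/-- The sets of primes of degree at least `2` avoiding `S₂` whose product has degree `n` and takes
the values `b`. -/
noncomputable def classSubsets (K : ℕ) (S₂ : Finset 𝔽[X]) (n : ℤ) (b : 𝔽 → 𝔽) :
    Finset (Finset 𝔽[X]) :=
  (subsetsOfDeg (nonlinIrreds 𝔽 K \ S₂) n).filter fun S => ∀ x, (∏ P ∈ S, P).eval x = b x

/-- `P` if `P ∈ S₂` and `P ^ 2` otherwise: a product of distinct primes coprime to `S₂` is one that
is divisible by no `sieveFactor S₂ P`. -/
noncomputable def sieveFactor (S₂ : Finset 𝔽[X]) (P : 𝔽[X]) : 𝔽[X] := if P ∈ S₂ then P else P ^ 2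

theorem card_classSubsets {K : ℕ} {S₂ : Finset 𝔽[X]} {n : ℤ} (hn : n ≤ K)
    {b : 𝔽 → 𝔽} (hb : ∀ x, b x ≠ 0) :
    (classSubsets K S₂ n b).card =
      ((monicClass n b).filter fun M => ∀ P ∈ nonlinIrreds 𝔽 K, ¬ sieveFactor S₂ P ∣ M).card := by
  refine Finset.card_bij (fun S _ => ∏ P ∈ S, P) ?_ ?_ ?_
  · intro S hS
    simp only [classSubsets, Finset.mem_filter, mem_subsetsOfDeg, mem_monicClass] at hS ⊢
    obtain ⟨⟨h1, h2⟩, h3⟩ := hS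
    have hp : IsPrimeSet S := (isPrimeSet_nonlinIrreds K).mono (h1.trans Finset.sdiff_subset)
    refine ⟨⟨hp.monic_prod, by rw [hp.natDegree_prod]; exact h2, h3⟩, fun P hP hd => ?_⟩
    have hP' := isPrimeSet_nonlinIrreds K P hP
    rw [sieveFactor] at hd
    split_ifs at hd with hPS
    · rw [hp.dvd_prod_iff hP'.1 hP'.2] at hd
      exact (Finset.mem_sdiff.1 (h1 hd)).2 hPS
    · rw [sq] at hd
      exact hP'.2.not_isUnit (hp.squarefree_prod P hd)
  · intro S hS T hT h
    simp only [classSubsets, Finset.mem_filter, mem_subsetsOfDeg] at hS hT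
    exact ((isPrimeSet_nonlinIrreds K).mono (hS.1.1.trans Finset.sdiff_subset)).prod_injOn
      ((isPrimeSet_nonlinIrreds K).mono (hT.1.1.trans Finset.sdiff_subset)) h
  · intro M hM
    simp only [Finset.mem_filter, mem_monicClass] at hM
    obtain ⟨⟨h1, h2, h3⟩, h4⟩ := hM
    have hMK : M.natDegree ≤ K := by omega
    have hM0 : ∀ x, M.eval x ≠ 0 := fun x => by rw [h3]; exact hb x
    have hsq : Squarefree M := by
      rw [squarefree_iff_irreducible_sq_not_dvd_of_ne_zero h1.ne_zero]
      intro P₀ hP₀ hd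
      obtain ⟨P, hPm, hPi, hPP⟩ := exists_monic_irreducible_factor P₀ hP₀.not_isUnit
      have hPM : P * P ∣ M := (mul_dvd_mul hPP hPP).trans hd
      refine h4 P (mem_nonlinIrreds_of_dvd hPm hPi h1.ne_zero hMK hM0
        ((dvd_mul_right _ _).trans hPM)) ?_
      rw [sieveFactor]
      split_ifs
      · exact (dvd_mul_right _ _).trans hPM
      · rwa [sq]
    obtain ⟨h5, h6⟩ := exists_irreds_prod_eq h1 hsq hMK
    refine ⟨_, ?_, h6⟩
    simp only [classSubsets, Finset.mem_filter, mem_subsetsOfDeg]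
    refine ⟨⟨fun P hP => ?_, ?_⟩, fun x => by rw [h6, h3]⟩
    · rw [Finset.mem_filter, mem_irreds] at hP
      have hmem := mem_nonlinIrreds_of_dvd hP.1.1 hP.1.2.2 h1.ne_zero hMK hM0 hP.2
      refine Finset.mem_sdiff.2 ⟨hmem, fun hPS => h4 P hmem ?_⟩
      rw [sieveFactor, if_pos hPS]
      exact hP.2
    · rw [← ((isPrimeSet_irreds K).mono h5).natDegree_prod, h6, h2]

theorem sieveFactor_monic {K : ℕ} (S₂ : Finset 𝔽[X]) {P : 𝔽[X]} (hP : P ∈ nonlinIrreds 𝔽 K) :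
    (sieveFactor S₂ P).Monic := by
  have := (isPrimeSet_nonlinIrreds K P hP).1
  rw [sieveFactor]
  split_ifs
  · exact this
  · exact this.pow 2

theorem sieveFactor_eval_ne_zero {K : ℕ} (S₂ : Finset 𝔽[X]) {P : 𝔽[X]}
    (hP : P ∈ nonlinIrreds 𝔽 K) (x : 𝔽) : (sieveFactor S₂ P).eval x ≠ 0 := by
  have := eval_ne_zero_of_mem_nonlinIrreds hP x
  rw [sieveFactor]
  split_ifs
  · exact this
  · rw [eval_pow]; exact pow_ne_zero 2 this

theorem natDegree_prod_sieveFactor {K : ℕ} (S₂ : Finset 𝔽[X]) {S : Finset 𝔽[X]}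
    (hS : S ⊆ nonlinIrreds 𝔽 K) :
    (∏ P ∈ S, sieveFactor S₂ P).natDegree = degs (S ∩ S₂) + 2 * degs (S \ S₂) := by
  rw [natDegree_prod_of_monic _ _ fun P hP => sieveFactor_monic S₂ (hS hP),
    ← Finset.sum_inter_add_sum_sdiff S S₂, degs, degs, Finset.mul_sum]
  congr 1
  · refine Finset.sum_congr rfl fun P hP => ?_
    rw [sieveFactor, if_pos (Finset.mem_inter.1 hP).2]
  · refine Finset.sum_congr rfl fun P hP => ?_
    rw [sieveFactor, if_neg (Finset.mem_sdiff.1 hP).2, natDegree_pow]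

theorem prod_sieveFactor_dvd_iff {K : ℕ} (S₂ : Finset 𝔽[X]) {S : Finset 𝔽[X]}
    (hS : S ⊆ nonlinIrreds 𝔽 K) (M : 𝔽[X]) :
    ∏ P ∈ S, sieveFactor S₂ P ∣ M ↔ ∀ P ∈ S, sieveFactor S₂ P ∣ M := by
  refine ⟨fun h P hP => (Finset.dvd_prod_of_mem _ hP).trans h, fun h => ?_⟩
  refine Finset.prod_dvd_of_coprime (fun P hP Q hQ hPQ => ?_) h
  have hc : IsCoprime P Q := (isPrimeSet_nonlinIrreds K).pairwise_isCoprime (hS hP) (hS hQ) hPQ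
  simp only [Function.onFun, sieveFactor]
  split_ifs
  · exact hc
  · exact hc.pow_right
  · exact hc.pow_left
  · exact hc.pow

/-- Inclusion-exclusion over the primes whose sieve factor divides M. Sieve factors of distinct
primes are coprime, so joint divisibility is divisibility by their product, which has no roots. -/
theorem card_classSubsets_eq_sum {K : ℕ} {S₂ : Finset 𝔽[X]} {n : ℤ} (hn : n ≤ K)
    {b : 𝔽 → 𝔽} (hb : ∀ x, b x ≠ 0) :
    ((classSubsets K S₂ n b).card : ℝ) = ∑ S ∈ (nonlinIrreds 𝔽 K).powerset, (-1) ^ S.card *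
      ((monicClass (n - (degs (S ∩ S₂) + 2 * degs (S \ S₂) : ℕ)) fun x =>
        b x / (∏ P ∈ S, sieveFactor S₂ P).eval x).card : ℝ) := by
  rw [card_classSubsets hn hb, Finset.card_filter, Nat.cast_sum]
  have h1 : ∀ M ∈ monicClass n b,
      (((if ∀ P ∈ nonlinIrreds 𝔽 K, ¬ sieveFactor S₂ P ∣ M then 1 else 0 : ℕ) : ℕ) : ℝ) =
      ∑ S ∈ (nonlinIrreds 𝔽 K).powerset, (-1) ^ S.card *
        if ∏ P ∈ S, sieveFactor S₂ P ∣ M then (1 : ℝ) else 0 := by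
    intro M _
    have h2 := Finset.sum_powerset_neg_one_pow_card
      (x := (nonlinIrreds 𝔽 K).filter (sieveFactor S₂ · ∣ M))
    have h3 : ((nonlinIrreds 𝔽 K).filter (sieveFactor S₂ · ∣ M)).powerset =
        (nonlinIrreds 𝔽 K).powerset.filter (∏ P ∈ ·, sieveFactor S₂ P ∣ M) := by
      ext S
      simp only [Finset.mem_powerset, Finset.mem_filter, Finset.subset_iff]
      constructor
      · intro h
        refine ⟨fun P hP => (h hP).1, ?_⟩
        rw [prod_sieveFactor_dvd_iff S₂ fun P hP => (h hP).1]
        exact fun P hP => (h hP).2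
      · rintro ⟨h, h'⟩ P hP
        exact ⟨h hP, (prod_sieveFactor_dvd_iff S₂ h M).1 h' P hP⟩
    rw [h3, Finset.sum_filter] at h2
    simp only [Finset.filter_eq_empty_iff] at h2
    have h4 := congrArg (Int.cast : ℤ → ℝ) h2
    push_cast at h4 ⊢
    simp only [mul_ite, mul_one, mul_zero]
    rw [h4]
  rw [Finset.sum_congr rfl h1, Finset.sum_comm]
  refine Finset.sum_congr rfl fun S hS => ?_
  rw [Finset.mem_powerset] at hS
  rw [← Finset.mul_sum, ← natDegree_prod_sieveFactor S₂ hS, ← card_filter_dvd_monicClass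
    (monic_prod_of_monic _ _ fun P hP => sieveFactor_monic S₂ (hS hP))
    (fun x => by
      rw [eval_prod]
      exact Finset.prod_ne_zero_iff.2 fun P hP => sieveFactor_eval_ne_zero S₂ (hS hP) x)]
  simp

end ValueClasses

/-! ### Main term and square-root error of the sieve. -/

section SieveEstimate

open scoped Classical

theorem sum_half_pow_natAbs_le (s : Finset ℤ) : ∑ i ∈ s, (1 / 2 : ℝ) ^ i.natAbs ≤ 4 := by
  have key : ∀ s : Finset ℤ, Set.InjOn Int.natAbs s → ∑ i ∈ s, (1 / 2 : ℝ) ^ i.natAbs ≤ 2 := by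
    intro s hs
    rw [← Finset.sum_image (f := fun n => (1 / 2 : ℝ) ^ n) (g := Int.natAbs) hs]
    calc _ ≤ ∑' n : ℕ, (1 / 2 : ℝ) ^ n :=
          summable_geometric_two.sum_le_tsum _ fun _ _ => by positivity
      _ = 2 := tsum_geometric_two
  rw [← Finset.sum_filter_add_sum_filter_not s (0 ≤ ·)]
  have h1 := key (s.filter (0 ≤ ·)) fun a ha b hb h => by
    simp only [Finset.coe_filter, Set.mem_ofPred_eq] at ha hb; omega
  have h2 := key (s.filter (¬ 0 ≤ ·)) fun a ha b hb h => by
    simp only [Finset.coe_filter, Set.mem_ofPred_eq] at ha hb; omega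
  linarith

variable {𝔽 : Type*} [Field 𝔽] [Fintype 𝔽]

theorem sum_powerset_comp_degs_le {S : Finset 𝔽[X]} (hS : IsPrimeSet S) {f : ℕ → ℝ}
    (hf : ∀ d, 0 ≤ f d) :
    ∑ D ∈ S.powerset, f (degs D) ≤
      ∑ d ∈ Finset.range (degs S + 1), (Fintype.card 𝔽 : ℝ) ^ d * f d := by
  have hmaps : ∀ D ∈ S.powerset, degs D ∈ Finset.range (degs S + 1) := fun D hD => by
    rw [Finset.mem_range, Nat.lt_succ_iff]
    exact Finset.sum_le_sum_of_subset (Finset.mem_powerset.1 hD)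
  rw [← Finset.sum_fiberwise_of_maps_to hmaps]
  refine Finset.sum_le_sum fun d _ => ?_
  rw [Finset.sum_congr rfl fun D hD => by rw [(Finset.mem_filter.1 hD).2], Finset.sum_const,
    nsmul_eq_mul]
  refine mul_le_mul_of_nonneg_right ?_ (hf d)
  have := card_subsetsOfDeg_le hS d
  rw [zpow_natCast] at this
  refine le_trans (le_of_eq ?_) this
  congr 2
  ext T
  simp

/-- At most q^d = t^(2d) sets have degree d, so degree d contributes at most t^(u - |u-2d|). This
decays geometrically on both sides of d = u/2. -/
theorem sum_powerset_zpow_le {S : Finset 𝔽[X]} (hS : IsPrimeSet S) {t : ℝ} (ht : 2 ≤ t)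
    (htq : t ^ 2 = Fintype.card 𝔽) (u : ℤ) :
    ∑ D ∈ S.powerset, t ^ (u - 2 * (degs D : ℤ) - |u - 2 * (degs D : ℤ)|) ≤ 4 * t ^ u := by
  have ht0 : t ≠ 0 := by positivity
  refine (sum_powerset_comp_degs_le hS (f := fun d => t ^ (u - 2 * (d : ℤ) - |u - 2 * (d : ℤ)|))
    fun d => by positivity).trans ?_
  calc _ ≤ ∑ d ∈ Finset.range (degs S + 1), t ^ u * (1 / 2 : ℝ) ^ (u - 2 * (d : ℤ)).natAbs := by
        refine Finset.sum_le_sum fun d _ => ?_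
        rw [← htq, ← pow_mul, ← zpow_natCast, ← zpow_add₀ ht0,
          show ((2 * d : ℕ) : ℤ) + (u - 2 * (d : ℤ) - |u - 2 * (d : ℤ)|) =
            u + -((u - 2 * (d : ℤ)).natAbs : ℤ) by push_cast [Int.natCast_natAbs]; ring,
          zpow_add₀ ht0, zpow_neg, zpow_natCast, one_div, inv_pow]
        gcongr
    _ = t ^ u * ∑ i ∈ (Finset.range (degs S + 1)).image (fun d : ℕ => u - 2 * (d : ℤ)),
        (1 / 2 : ℝ) ^ i.natAbs := by
        rw [Finset.sum_image, Finset.mul_sum]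
        intro a _ b _ h
        simp only at h
        omega
    _ ≤ 4 * t ^ u := by
        rw [mul_comm]
        exact mul_le_mul_of_nonneg_right (sum_half_pow_natAbs_le _) (by positivity)

variable (𝔽) in
/-- The proportion of square-free polynomials among the monic polynomials without roots, as far as
primes of degree at most `K` are concerned. -/
noncomputable def sqfreeDensity (K : ℕ) : ℝ :=
  ∏ P ∈ nonlinIrreds 𝔽 K, (1 - ((Fintype.card 𝔽 : ℝ) ^ (2 * P.natDegree))⁻¹)

/-- The local density `1 / (1 + |P|⁻¹)`. -/
noncomputable def coprimeDensity (P : 𝔽[X]) : ℝ :=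
  (1 + ((Fintype.card 𝔽 : ℝ) ^ P.natDegree)⁻¹)⁻¹

/-- With x = |P|⁻¹, a prime in S₂ contributes 1 - x = (1 - x²)/(1 + x), and any other prime 1 - x².
-/
theorem prod_one_sub_sieveFactor {K : ℕ} {S₂ : Finset 𝔽[X]} (hS₂ : S₂ ⊆ nonlinIrreds 𝔽 K) :
    ∏ P ∈ nonlinIrreds 𝔽 K, (1 - ((Fintype.card 𝔽 : ℝ) ^ (sieveFactor S₂ P).natDegree)⁻¹) =
      sqfreeDensity 𝔽 K * ∏ P ∈ S₂, coprimeDensity P := by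
  have h1 : ∏ P ∈ S₂, coprimeDensity P =
      ∏ P ∈ nonlinIrreds 𝔽 K, if P ∈ S₂ then coprimeDensity P else 1 := by
    rw [Finset.prod_ite, Finset.prod_const_one, mul_one, Finset.filter_mem_eq_inter,
      Finset.inter_eq_right.2 hS₂]
  rw [h1, sqfreeDensity, ← Finset.prod_mul_distrib]
  refine Finset.prod_congr rfl fun P _ => ?_
  have hq : (0 : ℝ) < Fintype.card 𝔽 := by exact_mod_cast Fintype.card_pos
  rw [sieveFactor]
  split_ifs
  · rw [coprimeDensity, pow_mul']
    have : (0 : ℝ) < (Fintype.card 𝔽 : ℝ) ^ P.natDegree := by positivity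
    field_simp
    ring
  · rw [natDegree_pow, mul_one]

/-- Square-free polynomials with prescribed nonzero values and coprime to `∏ P ∈ S₂, P` are
equidistributed, with square-root cancellation. -/
theorem abs_card_classSubsets_sub_le {K : ℕ} {S₂ : Finset 𝔽[X]} (hS₂ : S₂ ⊆ nonlinIrreds 𝔽 K)
    {n : ℤ} (hn : n ≤ K) {b : 𝔽 → 𝔽} (hb : ∀ x, b x ≠ 0) {t : ℝ} (ht : 2 ≤ t)
    (htq : t ^ 2 = Fintype.card 𝔽) :
    |((classSubsets K S₂ n b).card : ℝ) - (Fintype.card 𝔽 : ℝ) ^ (n - (Fintype.card 𝔽 : ℤ)) *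
      (sqfreeDensity 𝔽 K * ∏ P ∈ S₂, coprimeDensity P)| ≤
      4 * t ^ n * ∑ E ∈ S₂.powerset, t ^ (-(degs E : ℤ)) := by
  have ht0 : t ≠ 0 := by positivity
  have hq0 : (Fintype.card 𝔽 : ℝ) ≠ 0 := by rw [← htq]; positivity
  rw [card_classSubsets_eq_sum hn hb, ← prod_one_sub_sieveFactor hS₂]
  simp_rw [sub_eq_add_neg (1 : ℝ), Finset.prod_one_add]
  rw [Finset.mul_sum, ← Finset.sum_sub_distrib]
  refine (Finset.abs_sum_le_sum_abs _ _).trans ?_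
  calc _ ≤ ∑ S ∈ (nonlinIrreds 𝔽 K).powerset,
        t ^ (n - (degs (S ∩ S₂) : ℤ) - 2 * (degs (S \ S₂) : ℤ) -
          |n - (degs (S ∩ S₂) : ℤ) - 2 * (degs (S \ S₂) : ℤ)|) := by
        refine Finset.sum_le_sum fun S hS => ?_
        rw [Finset.mem_powerset] at hS
        -- Expanding the Euler product gives one term per set S, which is exactly the main term of
        -- the summand for S in the inclusion-exclusion.
        have hmain : (Fintype.card 𝔽 : ℝ) ^ (n - (Fintype.card 𝔽 : ℤ)) *
            ∏ P ∈ S, -((Fintype.card 𝔽 : ℝ) ^ (sieveFactor S₂ P).natDegree)⁻¹ =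
            (-1) ^ S.card * (Fintype.card 𝔽 : ℝ) ^
              (n - (degs (S ∩ S₂) + 2 * degs (S \ S₂) : ℕ) - (Fintype.card 𝔽 : ℤ)) := by
          rw [← natDegree_prod_sieveFactor S₂ hS,
            natDegree_prod_of_monic _ _ fun P hP => sieveFactor_monic S₂ (hS hP),
            show n - ((∑ P ∈ S, (sieveFactor S₂ P).natDegree : ℕ) : ℤ) - (Fintype.card 𝔽 : ℤ) =
              n - (Fintype.card 𝔽 : ℤ) - ((∑ P ∈ S, (sieveFactor S₂ P).natDegree : ℕ) : ℤ) by ring,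
            zpow_sub₀ hq0 (n - (Fintype.card 𝔽 : ℤ)), zpow_natCast, ← Finset.prod_pow_eq_pow_sum,
            Finset.prod_neg, Finset.prod_inv_distrib]
          ring
        rw [hmain, ← mul_sub, abs_mul, abs_pow, abs_neg, abs_one, one_pow, one_mul]
        refine (abs_card_monicClass_sub_le htq _ _).trans (le_of_eq ?_)
        push_cast
        rw [← sub_sub n]
    -- S is determined by its parts inside and outside S₂. They enter the degree with weights 1 and
    -- 2, so the sum is over pairs, and enlarging to all pairs costs nothing because the terms are
    -- nonnegative.
    _ = ∑ x ∈ (nonlinIrreds 𝔽 K).powerset.image (fun S => (S ∩ S₂, S \ S₂)),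
        t ^ (n - (degs x.1 : ℤ) - 2 * (degs x.2 : ℤ) -
          |n - (degs x.1 : ℤ) - 2 * (degs x.2 : ℤ)|) := by
        rw [Finset.sum_image]
        intro S _ T _ h
        simp only [Prod.mk.injEq] at h
        rw [← Finset.sdiff_union_inter S S₂, h.1, h.2, Finset.sdiff_union_inter]
    _ ≤ ∑ x ∈ S₂.powerset ×ˢ (nonlinIrreds 𝔽 K).powerset,
        t ^ (n - (degs x.1 : ℤ) - 2 * (degs x.2 : ℤ) -
          |n - (degs x.1 : ℤ) - 2 * (degs x.2 : ℤ)|) := by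
        refine Finset.sum_le_sum_of_subset_of_nonneg ?_ fun _ _ _ => by positivity
        intro x hx
        obtain ⟨S, hS, rfl⟩ := Finset.mem_image.1 hx
        rw [Finset.mem_powerset] at hS
        simp only [Finset.mem_product, Finset.mem_powerset]
        exact ⟨Finset.inter_subset_right, Finset.sdiff_subset.trans hS⟩
    _ ≤ ∑ E ∈ S₂.powerset, 4 * t ^ (n - (degs E : ℤ)) := by
        rw [Finset.sum_product]
        refine Finset.sum_le_sum fun E _ => ?_
        have := sum_powerset_zpow_le (isPrimeSet_nonlinIrreds (𝔽 := 𝔽) K) ht htq (n - (degs E : ℤ))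
        exact this
    _ = _ := by
        rw [Finset.mul_sum]
        refine Finset.sum_congr rfl fun E _ => ?_
        rw [sub_eq_add_neg, zpow_add₀ ht0, mul_assoc]

/-- Exchange the sums: at most q^(k - deg E) sets T contain a given E, and at most q^d sets E have
degree d. What remains is q^k ∑ t^(-d) ≤ 2q^k. So the divisor sum in the sieve error is bounded on
average over S₂. -/
theorem sum_sum_powerset_zpow_neg_le {S : Finset 𝔽[X]} (hS : IsPrimeSet S) {t : ℝ} (ht : 2 ≤ t)
    (htq : t ^ 2 = Fintype.card 𝔽) (k : ℤ) :
    ∑ T ∈ subsetsOfDeg S k, ∑ E ∈ T.powerset, t ^ (-(degs E : ℤ)) ≤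
      2 * (Fintype.card 𝔽 : ℝ) ^ k := by
  have ht0 : t ≠ 0 := by positivity
  have hq0 : (Fintype.card 𝔽 : ℝ) ≠ 0 := by rw [← htq]; positivity
  have hcard : ∀ E ∈ S.powerset, (((subsetsOfDeg S k).filter (E ⊆ ·)).card : ℝ) ≤
      (Fintype.card 𝔽 : ℝ) ^ (k - (degs E : ℤ)) := by
    intro E hE
    refine le_trans ?_ (card_subsetsOfDeg_le hS (k - (degs E : ℤ)))
    norm_cast
    refine Finset.card_le_card_of_injOn (· \ E) ?_ ?_
    · intro T hT
      simp only [Finset.coe_filter, mem_subsetsOfDeg, Set.mem_ofPred_eq, Finset.mem_coe] at hT ⊢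
      refine ⟨Finset.sdiff_subset.trans hT.1.1, ?_⟩
      have := degs_union (Finset.disjoint_sdiff (s := E) (t := T))
      rw [Finset.union_sdiff_of_subset hT.2] at this
      omega
    · intro T hT U hU h
      simp only [Finset.coe_filter, mem_subsetsOfDeg, Set.mem_ofPred_eq] at hT hU h
      rw [← Finset.union_sdiff_of_subset hT.2, h, Finset.union_sdiff_of_subset hU.2]
  calc _ = ∑ T ∈ subsetsOfDeg S k, ∑ E ∈ S.powerset,
        if E ⊆ T then t ^ (-(degs E : ℤ)) else 0 := by
        refine Finset.sum_congr rfl fun T hT => ?_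
        rw [← Finset.sum_filter]
        refine Finset.sum_congr ?_ fun _ _ => rfl
        rw [mem_subsetsOfDeg] at hT
        ext E
        simp only [Finset.mem_powerset, Finset.mem_filter]
        exact ⟨fun h => ⟨h.trans hT.1, h⟩, fun h => h.2⟩
    _ = ∑ E ∈ S.powerset, (((subsetsOfDeg S k).filter (E ⊆ ·)).card : ℝ) *
        t ^ (-(degs E : ℤ)) := by
        rw [Finset.sum_comm]
        refine Finset.sum_congr rfl fun E _ => ?_
        rw [← Finset.sum_filter, Finset.sum_const, nsmul_eq_mul]
    _ ≤ ∑ E ∈ S.powerset, (Fintype.card 𝔽 : ℝ) ^ (k - (degs E : ℤ)) * t ^ (-(degs E : ℤ)) :=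
        Finset.sum_le_sum fun E hE => mul_le_mul_of_nonneg_right (hcard E hE) (by positivity)
    _ ≤ ∑ d ∈ Finset.range (degs S + 1), (Fintype.card 𝔽 : ℝ) ^ d *
        ((Fintype.card 𝔽 : ℝ) ^ (k - (d : ℤ)) * t ^ (-(d : ℤ))) :=
        sum_powerset_comp_degs_le hS
          (f := fun d => (Fintype.card 𝔽 : ℝ) ^ (k - (d : ℤ)) * t ^ (-(d : ℤ)))
          fun _ => by positivity
    _ ≤ ∑ d ∈ Finset.range (degs S + 1), (Fintype.card 𝔽 : ℝ) ^ k * (1 / 2) ^ d := by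
        refine Finset.sum_le_sum fun d _ => ?_
        rw [← mul_assoc, ← zpow_natCast, ← zpow_add₀ hq0, add_sub_cancel, zpow_neg, zpow_natCast,
          one_div, inv_pow]
        gcongr
    _ ≤ _ := by
        rw [← Finset.mul_sum, mul_comm]
        refine mul_le_mul_of_nonneg_right ?_ (by positivity)
        exact (summable_geometric_two.sum_le_tsum _ fun _ _ => by positivity).trans
          tsum_geometric_two.le

end SieveEstimate

/-! ### Averages of multiplicative weights over square-free polynomials. -/

section WeightedSums

open scoped Classical

/-- If the generating functions satisfy `(1 + v ^ p) g(v) = (1 + β v ^ p) f(v)`, an asymptotic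
formula `f k ≈ c * q ^ k` passes to `g`. -/
theorem abs_sub_le_of_add_shift_eq {f g : ℤ → ℝ} {q r c B β : ℝ} {p : ℕ} {K : ℤ} (hp : 0 < p)
    (hq : 1 < q) (hqr : q⁻¹ ≤ r) (hr : r < 1) (hβ0 : 0 ≤ β) (hβ : β ≤ 1) (hc : 0 ≤ c)
    (hcB : c ≤ B) (hf0 : ∀ k < 0, f k = 0) (hg0 : ∀ k < 0, g k = 0)
    (hfg : ∀ k, g k + g (k - p) = f k + β * f (k - p))
    (hf : ∀ k ≤ K, |f k - c * q ^ k| ≤ B * r ^ (-k)) :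
    ∀ k ≤ K, |g k - c * ((1 + β * (q ^ p)⁻¹) / (1 + (q ^ p)⁻¹)) * q ^ k| ≤
      B * (1 + (1 - β) * (r ^ p / (1 - r ^ p))) * r ^ (-k) := by
  have hq0 : 0 < q := by linarith
  have hr0 : 0 < r := (inv_pos.2 hq0).trans_le hqr
  set x : ℝ := (q ^ p)⁻¹ with hx
  set y : ℝ := r ^ p with hy
  have hx0 : 0 < x := by positivity
  have hy0 : 0 < y := by positivity
  have hxy : x ≤ y := by
    rw [hx, ← inv_pow]
    exact pow_le_pow_left₀ (by positivity) hqr p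
  have hy1 : 0 < 1 - y := by
    have := pow_lt_one₀ hr0.le hr hp.ne'
    linarith
  have hB : 0 ≤ B := hc.trans hcB
  set c' : ℝ := c * ((1 + β * x) / (1 + x)) with hc'
  -- D is the fixed point of D ↦ y(D + (1-β)B), the recursion satisfied by the bound when k
  -- increases by p.
  set D : ℝ := (1 - β) * B * y / (1 - y) with hD
  have hD0 : 0 ≤ D := by
    have : 0 ≤ 1 - β := by linarith
    positivity
  have hDeq : y * (D + (1 - β) * B) = D := by
    rw [hD]; field_simp; ring
  have hcc : c - c' = c * ((1 - β) * x / (1 + x)) := by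
    rw [hc']; field_simp; ring
  have hqk : ∀ k : ℤ, q ^ (k - p) = q ^ k * x := fun k => by
    rw [zpow_sub₀ hq0.ne', zpow_natCast, hx, div_eq_mul_inv]
  have hrk : ∀ k : ℤ, r ^ (-(k - p)) = r ^ (-k) * y := fun k => by
    rw [show -(k - (p : ℤ)) = -k + p by ring, zpow_add₀ hr0.ne', zpow_natCast]
  have key : ∀ m : ℕ, ∀ k : ℤ, k < m → k ≤ K →
      |(g k - c' * q ^ k) - (f k - c * q ^ k)| ≤ D * r ^ (-k) := by
    -- Below degree 0 both f and g vanish but their main terms do not. The difference of these is at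
    -- most D·r^(-k); this is where c ≤ B and q⁻¹ ≤ r are needed.
    have hneg : ∀ k < 0, |(g k - c' * q ^ k) - (f k - c * q ^ k)| ≤ D * r ^ (-k) := by
      intro k hk
      rw [hf0 k hk, hg0 k hk, show (0 - c' * q ^ k) - (0 - c * q ^ k) = (c - c') * q ^ k by ring,
        hcc]
      have h1 : q ^ k ≤ r ^ (-k) := by
        rw [← neg_neg k, zpow_neg, ← inv_zpow, neg_neg]
        exact zpow_le_zpow_left₀ (by omega) (by positivity) hqr
      have h2 : c * ((1 - β) * x / (1 + x)) ≤ D := by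
        have h3 : (1 - β) * x / (1 + x) ≤ (1 - β) * y / (1 - y) := by
          have : 0 ≤ 1 - β := by linarith
          gcongr
          linarith
        calc _ ≤ B * ((1 - β) * y / (1 - y)) := by
              have : 0 ≤ 1 - β := by linarith
              gcongr
          _ = D := by rw [hD]; ring
      have h4 : 0 ≤ c * ((1 - β) * x / (1 + x)) := by
        have : 0 ≤ 1 - β := by linarith
        positivity
      rw [abs_of_nonneg (by positivity)]
      gcongr
    intro m
    induction m with
    | zero => intro k hk _; exact hneg k (by exact_mod_cast hk)
    | succ m ih =>
      intro k hk hkK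
      rcases lt_or_ge k 0 with h0 | h0
      · exact hneg k h0
      · have h1 := ih (k - p) (by push_cast at hk; omega) (by omega)
        have h2 := hf (k - p) (by omega)
        -- The constant c' satisfies c'(1 + q^(-p)) = c(1 + βq^(-p)), so the main terms obey the
        -- same shift relation and it passes to the errors.
        have h3 : (g k - c' * q ^ k) - (f k - c * q ^ k) =
            -((g (k - p) - c' * q ^ (k - p)) - (f (k - p) - c * q ^ (k - p))) -
            (1 - β) * (f (k - p) - c * q ^ (k - p)) := by
          have h4 := hfg k
          have h5 : c' * (1 + x) = c * (1 + β * x) := by rw [hc']; field_simp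
          rw [hqk]
          linear_combination h4 - q ^ k * h5
        rw [h3]
        refine (abs_sub _ _).trans ?_
        rw [abs_neg, abs_mul, abs_of_nonneg (by linarith : (0 : ℝ) ≤ 1 - β)]
        calc _ ≤ D * r ^ (-(k - p)) + (1 - β) * (B * r ^ (-(k - p))) := by
              have : 0 ≤ 1 - β := by linarith
              gcongr
          _ = (y * (D + (1 - β) * B)) * r ^ (-k) := by rw [hrk]; ring
          _ = _ := by rw [hDeq]
  intro k hk
  have h1 := key (k.toNat + 1) k (by omega) hk
  have h2 := hf k hk
  calc |g k - c' * q ^ k|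
      = |((g k - c' * q ^ k) - (f k - c * q ^ k)) + (f k - c * q ^ k)| := by rw [sub_add_cancel]
    _ ≤ D * r ^ (-k) + B * r ^ (-k) := (abs_add_le _ _).trans (add_le_add h1 h2)
    _ = _ := by rw [hD]; ring

variable {𝔽 : Type*} [Field 𝔽] [Fintype 𝔽]

/-- The sum of `∏ P ∈ T, w P` over the subsets `T` of `S` whose product has degree `k`. -/
noncomputable def weightedSum (S : Finset 𝔽[X]) (w : 𝔽[X] → ℝ) (k : ℤ) : ℝ :=
  ∑ T ∈ subsetsOfDeg S k, ∏ P ∈ T, w P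

theorem weightedSum_of_neg (S : Finset 𝔽[X]) (w : 𝔽[X] → ℝ) {k : ℤ} (hk : k < 0) :
    weightedSum S w k = 0 := by
  have : subsetsOfDeg S k = ∅ := by
    ext T; simp only [mem_subsetsOfDeg, Finset.notMem_empty, iff_false]; omega
  rw [weightedSum, this, Finset.sum_empty]

theorem weightedSum_insert {S : Finset 𝔽[X]} {P : 𝔽[X]} (hP : P ∉ S) (w : 𝔽[X] → ℝ) (k : ℤ) :
    weightedSum (insert P S) w k = weightedSum S w k + w P * weightedSum S w (k - P.natDegree) := by
  simp only [weightedSum, subsetsOfDeg, Finset.sum_filter]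
  rw [Finset.sum_powerset_insert hP, Finset.mul_sum]
  congr 1
  refine Finset.sum_congr rfl fun T hT => ?_
  have hPT : P ∉ T := fun h => hP (Finset.mem_powerset.1 hT h)
  have hd : degs (insert P T) = P.natDegree + degs T := Finset.sum_insert hPT
  rw [Finset.prod_insert hPT, hd, mul_ite, mul_zero]
  refine if_congr ?_ rfl rfl
  push_cast
  constructor <;> intro h <;> omega

theorem weightedSum_congr {S : Finset 𝔽[X]} {w w' : 𝔽[X] → ℝ} (h : ∀ P ∈ S, w P = w' P) (k : ℤ) :
    weightedSum S w k = weightedSum S w' k :=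
  Finset.sum_congr rfl fun _ hT => Finset.prod_congr rfl fun P hP =>
    h P ((mem_subsetsOfDeg.1 hT).1 hP)

/-- Replacing the weight `1` of the primes in `U` by `β` multiplies the main term of a weighted sum
by the corresponding Euler factors. -/
theorem abs_weightedSum_sub_le {S : Finset 𝔽[X]} (hS : IsPrimeSet S) {β : 𝔽[X] → ℝ} {q r c : ℝ}
    {K : ℤ} (hq : 1 < q) (hqr : q⁻¹ ≤ r) (hr : r < 1) (hβ0 : ∀ P, 0 ≤ β P) (hβ : ∀ P, β P ≤ 1)
    (hc : 0 ≤ c) (hc1 : c ≤ 1)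
    (hbase : ∀ k ≤ K, |((subsetsOfDeg S k).card : ℝ) - c * q ^ k| ≤ r ^ (-k))
    {U : Finset 𝔽[X]} (hU : U ⊆ S) :
    ∀ k ≤ K, |weightedSum S (fun P => if P ∈ U then β P else 1) k -
        (c * ∏ P ∈ U, (1 + β P * (q ^ P.natDegree)⁻¹) / (1 + (q ^ P.natDegree)⁻¹)) * q ^ k| ≤
      (∏ P ∈ U, (1 + (1 - β P) * (r ^ P.natDegree / (1 - r ^ P.natDegree)))) * r ^ (-k) := by
  have hq0 : 0 < q := by linarith
  have hr0 : 0 < r := (inv_pos.2 hq0).trans_le hqr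
  induction U using Finset.induction_on with
  | empty => simpa [weightedSum] using hbase
  | insert P U hPU ih =>
    have hPS : P ∈ S := hU (Finset.mem_insert_self _ _)
    have ih' := ih ((Finset.subset_insert _ _).trans hU)
    have hpos := hS.natDegree_pos hPS
    rw [Finset.prod_insert hPU, Finset.prod_insert hPU]
    have hfac1 : ∀ P ∈ U, (0 : ℝ) ≤ (1 + β P * (q ^ P.natDegree)⁻¹) / (1 + (q ^ P.natDegree)⁻¹) :=
      fun P _ => by
        have := hβ0 P
        positivity
    have hfac2 : ∀ P ∈ U, (1 + β P * (q ^ P.natDegree)⁻¹) / (1 + (q ^ P.natDegree)⁻¹) ≤ 1 :=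
      fun P _ => by
        have h1 := hβ P
        have h2 : (0 : ℝ) < (q ^ P.natDegree)⁻¹ := by positivity
        rw [div_le_one (by positivity)]
        nlinarith
    have hfac3 : ∀ P ∈ U, (1 : ℝ) ≤ 1 + (1 - β P) * (r ^ P.natDegree / (1 - r ^ P.natDegree)) :=
      fun P _ => by
        have h1 : 0 ≤ 1 - β P := by linarith [hβ P]
        have h2 : 0 ≤ 1 - r ^ P.natDegree := by linarith [pow_le_one₀ (n := P.natDegree) hr0.le hr.le]
        have : 0 ≤ (1 - β P) * (r ^ P.natDegree / (1 - r ^ P.natDegree)) := by positivity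
        linarith
    have hprod1 := Finset.prod_nonneg hfac1
    have hprod2 := Finset.prod_le_one hfac1 hfac2
    have hprod3 : (1 : ℝ) ≤ ∏ P ∈ U, (1 + (1 - β P) * (r ^ P.natDegree / (1 - r ^ P.natDegree))) := by
      exact (Finset.prod_const_one (s := U)).symm.le.trans
        (Finset.prod_le_prod (fun _ _ => zero_le_one) hfac3)
    have hres := abs_sub_le_of_add_shift_eq (f := weightedSum S fun P => if P ∈ U then β P else 1)
      (g := weightedSum S fun Q => if Q ∈ insert P U then β Q else 1) hpos hq hqr hr (hβ0 P) (hβ P)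
      (mul_nonneg hc hprod1)
      ((mul_le_one₀ hc1 hprod1 hprod2).trans hprod3)
      (fun k hk => weightedSum_of_neg _ _ hk) (fun k hk => weightedSum_of_neg _ _ hk) ?_ ih'
    · intro k hk
      refine le_trans (le_of_eq ?_) ((hres k hk).trans (le_of_eq ?_))
      · congr 2; ring
      · ring
    · intro k
      -- If h is the weighted sum over the other primes, then f = h + h(· - p) and g = h + βh(· -
      -- p). Both sides of the shift relation therefore expand to the same combination of h.
      rw [← Finset.insert_erase hPS]
      have hne := Finset.notMem_erase P S
      have hcongr : ∀ k, weightedSum (S.erase P) (fun Q => if Q ∈ insert P U then β Q else 1) k =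
          weightedSum (S.erase P) (fun Q => if Q ∈ U then β Q else 1) k := fun k =>
        weightedSum_congr (fun Q hQ => by
          simp [Finset.ne_of_mem_erase hQ]) k
      simp only [weightedSum_insert hne, hcongr, Finset.mem_insert_self, if_true, if_neg hPU]
      ring

theorem sum_natDegree_comp_le {S : Finset 𝔽[X]} (hS : ∀ P ∈ S, P.Monic) {I : Finset ℕ}
    (hI : ∀ P ∈ S, P.natDegree ∈ I) {f : ℕ → ℝ} (hf : ∀ d, 0 ≤ f d) :
    ∑ P ∈ S, f P.natDegree ≤ ∑ d ∈ I, (Fintype.card 𝔽 : ℝ) ^ d * f d := by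
  rw [← Finset.sum_fiberwise_of_maps_to hI]
  refine Finset.sum_le_sum fun d _ => ?_
  rw [Finset.sum_congr rfl fun P hP => by rw [(Finset.mem_filter.1 hP).2], Finset.sum_const,
    nsmul_eq_mul]
  refine mul_le_mul_of_nonneg_right ?_ (hf d)
  rw [← Nat.cast_pow, ← card_monics, Nat.cast_le]
  refine Finset.card_le_card fun P hP => ?_
  rw [Finset.mem_filter] at hP
  exact mem_monics.2 ⟨hS P hP.1, hP.2⟩

/-- For k ≥ 2 the count equals the main term. The discrepancy is q⁻¹ at k = 0 and 1 at k = 1, and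
for k < 0 the main term itself is at most r^(-k), because q⁻¹ ≤ r. -/
theorem abs_card_subsetsOfDeg_irreds_sub_le {q r : ℝ} (hq : (Fintype.card 𝔽 : ℝ) = q)
    (hqr : q⁻¹ ≤ r) (hr : r < 1) (K : ℕ) :
    ∀ k : ℤ, k ≤ K → |((subsetsOfDeg (irreds 𝔽 K) k).card : ℝ) - (1 - q⁻¹) * q ^ k| ≤
      r ^ (-k) := by
  intro k hk
  have hq1 : 1 < q := by rw [← hq]; exact_mod_cast Fintype.one_lt_card
  have hq0 : 0 < q := by linarith
  have hr0 : 0 < r := (inv_pos.2 hq0).trans_le hqr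
  have hqi : q⁻¹ ≤ 1 := inv_le_one_of_one_le₀ hq1.le
  have hqi0 : 0 < q⁻¹ := by positivity
  rcases lt_or_ge k 0 with hk0 | hk0
  · have : subsetsOfDeg (irreds 𝔽 K) k = ∅ := by
      ext T; simp only [mem_subsetsOfDeg, Finset.notMem_empty, iff_false]; omega
    have h1 : q ^ k ≤ r ^ (-k) := by
      rw [← neg_neg k, zpow_neg, ← inv_zpow, neg_neg]
      exact zpow_le_zpow_left₀ (by omega) (by positivity) hqr
    rw [this, Finset.card_empty, Nat.cast_zero, zero_sub, abs_neg, abs_of_nonneg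
      (mul_nonneg (by linarith) (by positivity))]
    have : 0 < q ^ k := by positivity
    nlinarith
  · lift k to ℕ using hk0
    rw [card_subsetsOfDeg_irreds (by exact_mod_cast hk)]
    match k with
    | 0 =>
      rw [card_sqfreeMonics_of_lt_two (by norm_num)]
      simp [abs_of_pos hqi0]
      simpa using hqi
    | 1 =>
      rw [card_sqfreeMonics_of_lt_two (by norm_num)]
      have : q - (1 - q⁻¹) * q = 1 := by field_simp; ring
      simp [hq, this]
      exact (one_le_inv₀ hr0).2 hr.le
    | n + 2 =>
      have h := card_sqfreeMonics_add_two (𝔽 := 𝔽) n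
      have h' := congrArg (Nat.cast : ℕ → ℝ) h
      push_cast at h'
      rw [hq] at h'
      have h2 : ((sqfreeMonics 𝔽 (n + 2)).card : ℝ) - (1 - q⁻¹) * q ^ (((n + 2 : ℕ)) : ℤ) = 0 := by
        rw [zpow_natCast]
        have : q⁻¹ * q ^ (n + 2) = q ^ (n + 1) := by field_simp; ring
        linear_combination h' + this
      rw [h2, abs_zero]
      positivity

end WeightedSums

/-! ### Bounds for the Euler products and the average over the second factor. -/

section Densities

open scoped Classical

theorem one_sub_sum_le_prod_one_sub {ι : Type*} (s : Finset ι) {x : ι → ℝ} (h0 : ∀ i ∈ s, 0 ≤ x i)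
    (h1 : ∀ i ∈ s, x i ≤ 1) : 1 - ∑ i ∈ s, x i ≤ ∏ i ∈ s, (1 - x i) := by
  induction s using Finset.induction_on with
  | empty => simp
  | insert a s ha ih =>
    rw [Finset.sum_insert ha, Finset.prod_insert ha]
    have h2 := ih (fun i hi => h0 i (Finset.mem_insert_of_mem hi))
      fun i hi => h1 i (Finset.mem_insert_of_mem hi)
    have h3 := h0 a (Finset.mem_insert_self _ _)
    have h4 := h1 a (Finset.mem_insert_self _ _)
    have h5 : 0 ≤ ∑ i ∈ s, x i := Finset.sum_nonneg fun i hi => h0 i (Finset.mem_insert_of_mem hi)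
    nlinarith [mul_le_mul_of_nonneg_left h2 (by linarith : 0 ≤ 1 - x a), mul_nonneg h3 h5]

variable {𝔽 : Type*} [Field 𝔽] [Fintype 𝔽]

theorem sqfreeDensity_le_one (K : ℕ) : sqfreeDensity 𝔽 K ≤ 1 := by
  have hq1 : (1 : ℝ) ≤ Fintype.card 𝔽 := by exact_mod_cast Fintype.card_pos
  refine Finset.prod_le_one (fun P _ => ?_) fun P _ => ?_
  · linarith [inv_le_one_of_one_le₀ (one_le_pow₀ hq1 (n := 2 * P.natDegree))]
  · have : (0 : ℝ) ≤ ((Fintype.card 𝔽 : ℝ) ^ (2 * P.natDegree))⁻¹ := by positivity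
    linarith

/-- The product is at least 1 - ∑ |P|⁻², and primes of degree d contribute at most q^(-d) ≤
(1/4)·2^(-d) for d ≥ 2. -/
theorem half_le_sqfreeDensity (h4 : 4 ≤ Fintype.card 𝔽) (K : ℕ) : 1 / 2 ≤ sqfreeDensity 𝔽 K := by
  have hq : (4 : ℝ) ≤ Fintype.card 𝔽 := by exact_mod_cast h4
  refine le_trans ?_ (one_sub_sum_le_prod_one_sub _ (fun P _ => by positivity)
    fun P _ => inv_le_one_of_one_le₀ (one_le_pow₀ (by linarith)))
  have h1 := sum_natDegree_comp_le (𝔽 := 𝔽) (S := nonlinIrreds 𝔽 K) (I := Finset.Icc 2 K)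
    (fun P hP => (isPrimeSet_nonlinIrreds K P hP).1)
    (fun P hP => by
      rw [nonlinIrreds, Finset.mem_filter, mem_irreds] at hP
      exact Finset.mem_Icc.2 ⟨hP.2, hP.1.2.1⟩)
    (f := fun d => ((Fintype.card 𝔽 : ℝ) ^ (2 * d))⁻¹) fun d => by positivity
  have h2 : ∑ d ∈ Finset.Icc 2 K, (Fintype.card 𝔽 : ℝ) ^ d * ((Fintype.card 𝔽 : ℝ) ^ (2 * d))⁻¹ ≤
      ∑ d ∈ Finset.Icc 2 K, (1 / 4) * (1 / 2 : ℝ) ^ d := by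
    refine Finset.sum_le_sum fun d hd => ?_
    have hd2 := (Finset.mem_Icc.1 hd).1
    have h3 : (Fintype.card 𝔽 : ℝ) ^ d * ((Fintype.card 𝔽 : ℝ) ^ (2 * d))⁻¹ =
        (((Fintype.card 𝔽 : ℝ)⁻¹) ^ d) := by
      rw [two_mul, pow_add, inv_pow]; field_simp
    rw [h3]
    calc ((Fintype.card 𝔽 : ℝ)⁻¹) ^ d ≤ ((1 / 2) * (1 / 2)) ^ d := by
          gcongr
          rw [inv_le_comm₀ (by linarith) (by norm_num)]
          norm_num; exact h4
      _ = (1 / 2) ^ d * (1 / 2) ^ d := mul_pow _ _ _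
      _ ≤ (1 / 4) * (1 / 2) ^ d := by
          gcongr
          calc (1 / 2 : ℝ) ^ d ≤ (1 / 2) ^ 2 :=
                pow_le_pow_of_le_one (by norm_num) (by norm_num) hd2
            _ = 1 / 4 := by norm_num
  have h3 : ∑ d ∈ Finset.Icc 2 K, (1 / 2 : ℝ) ^ d ≤ 2 :=
    (summable_geometric_two.sum_le_tsum _ fun _ _ => by positivity).trans tsum_geometric_two.le
  rw [← Finset.mul_sum] at h2
  linarith

theorem coprimeDensity_pos (P : 𝔽[X]) : 0 < coprimeDensity P := by
  rw [coprimeDensity]; positivity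

theorem coprimeDensity_le_one (P : 𝔽[X]) : coprimeDensity P ≤ 1 := by
  rw [coprimeDensity]
  refine inv_le_one_of_one_le₀ ?_
  have : (0 : ℝ) ≤ ((Fintype.card 𝔽 : ℝ) ^ P.natDegree)⁻¹ := by positivity
  linarith

/-- `coprimeDensity` on the primes of degree at least `2`, and `0` on linear polynomials. -/
noncomputable def nonlinDensity (P : 𝔽[X]) : ℝ := if P.natDegree = 1 then 0 else coprimeDensity P

theorem nonlinDensity_nonneg (P : 𝔽[X]) : 0 ≤ nonlinDensity P := by
  rw [nonlinDensity]; split_ifs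
  · exact le_rfl
  · exact (coprimeDensity_pos P).le

theorem nonlinDensity_le_one (P : 𝔽[X]) : nonlinDensity P ≤ 1 := by
  rw [nonlinDensity]; split_ifs
  · exact zero_le_one
  · exact coprimeDensity_le_one P

theorem irreds_eq_union (K : ℕ) : irreds 𝔽 K =
    (irreds 𝔽 K).filter (·.natDegree = 1) ∪ nonlinIrreds 𝔽 K := by
  ext P
  simp only [nonlinIrreds, Finset.mem_union, Finset.mem_filter]
  constructor
  · intro h
    have := (isPrimeSet_irreds K).natDegree_pos h
    by_cases h1 : P.natDegree = 1
    · exact Or.inl ⟨h, h1⟩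
    · exact Or.inr ⟨h, by omega⟩
  · rintro (h | h) <;> exact h.1

theorem disjoint_linear_nonlinIrreds (K : ℕ) :
    Disjoint ((irreds 𝔽 K).filter (·.natDegree = 1)) (nonlinIrreds 𝔽 K) := by
  rw [Finset.disjoint_left]
  intro P hP hP'
  simp only [nonlinIrreds, Finset.mem_filter] at hP hP'
  omega

theorem card_linear_irreds_le (K : ℕ) :
    ((irreds 𝔽 K).filter (·.natDegree = 1)).card ≤ Fintype.card 𝔽 := by
  rw [← pow_one (Fintype.card 𝔽), ← card_monics]
  refine Finset.card_le_card fun P hP => ?_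
  rw [Finset.mem_filter, mem_irreds] at hP
  exact mem_monics.2 ⟨hP.1.1, hP.2⟩

/-- Weight 0 on the linear primes discards every set containing one, so root-free polynomials are
counted by a weight on all primes, where the unweighted count is known exactly. -/
theorem weightedSum_nonlinDensity (K : ℕ) (k : ℤ) :
    weightedSum (irreds 𝔽 K) nonlinDensity k =
      ∑ T ∈ subsetsOfDeg (nonlinIrreds 𝔽 K) k, ∏ P ∈ T, coprimeDensity P := by
  rw [weightedSum, ← Finset.sum_subset (s₁ := subsetsOfDeg (nonlinIrreds 𝔽 K) k)]
  · refine Finset.sum_congr rfl fun T hT => Finset.prod_congr rfl fun P hP => ?_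
    have := (mem_subsetsOfDeg.1 hT).1 hP
    rw [nonlinIrreds, Finset.mem_filter] at this
    rw [nonlinDensity, if_neg (by omega)]
  · intro T hT
    rw [mem_subsetsOfDeg] at hT ⊢
    exact ⟨hT.1.trans (nonlinIrreds_subset K), hT.2⟩
  · intro T hT hT'
    rw [mem_subsetsOfDeg] at hT hT'
    have : ¬ T ⊆ nonlinIrreds 𝔽 K := fun h => hT' ⟨h, hT.2⟩
    rw [Finset.not_subset] at this
    obtain ⟨P, hP, hPn⟩ := this
    refine Finset.prod_eq_zero hP ?_
    have h1 := hT.1 hP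
    rw [irreds_eq_union, Finset.mem_union, or_iff_left hPn, Finset.mem_filter] at h1
    rw [nonlinDensity, if_pos h1.2]

variable (𝔽) in
/-- The constant in the asymptotic formula for the average of `∏ P ∈ T, coprimeDensity P`. -/
noncomputable def meanDensity (K : ℕ) : ℝ :=
  (1 - (Fintype.card 𝔽 : ℝ)⁻¹) * ∏ P ∈ irreds 𝔽 K,
    (1 + nonlinDensity P * ((Fintype.card 𝔽 : ℝ) ^ P.natDegree)⁻¹) /
      (1 + ((Fintype.card 𝔽 : ℝ) ^ P.natDegree)⁻¹)

theorem meanDensity_le_one (K : ℕ) : meanDensity 𝔽 K ≤ 1 := by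
  have hq1 : (1 : ℝ) ≤ Fintype.card 𝔽 := by exact_mod_cast Fintype.card_pos
  have h0 : ∀ P : 𝔽[X], (0 : ℝ) < ((Fintype.card 𝔽 : ℝ) ^ P.natDegree)⁻¹ := fun P => by positivity
  refine mul_le_one₀ ?_ ?_ ?_
  · have : (0 : ℝ) ≤ (Fintype.card 𝔽 : ℝ)⁻¹ := by positivity
    linarith
  · exact Finset.prod_nonneg fun P _ => by
      have := h0 P
      have := nonlinDensity_nonneg P
      positivity
  · refine Finset.prod_le_one (fun P _ => ?_) fun P _ => ?_
    · have := h0 P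
      have := nonlinDensity_nonneg P
      positivity
    · rw [div_le_one (by have := h0 P; positivity)]
      nlinarith [h0 P, nonlinDensity_le_one P]

/-- There are at most q linear primes, each with factor (1 + 1/q)⁻¹, and (1 + 1/q)^q ≤ e. -/
theorem exp_neg_one_le_prod_linear (K : ℕ) :
    Real.exp (-1) ≤ ∏ P ∈ (irreds 𝔽 K).filter (·.natDegree = 1),
      (1 + nonlinDensity P * ((Fintype.card 𝔽 : ℝ) ^ P.natDegree)⁻¹) /
        (1 + ((Fintype.card 𝔽 : ℝ) ^ P.natDegree)⁻¹) := by
  have hq : (0 : ℝ) < Fintype.card 𝔽 := by exact_mod_cast Fintype.card_pos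
  have h1 : ∀ P ∈ (irreds 𝔽 K).filter (·.natDegree = 1),
      (1 + nonlinDensity P * ((Fintype.card 𝔽 : ℝ) ^ P.natDegree)⁻¹) /
        (1 + ((Fintype.card 𝔽 : ℝ) ^ P.natDegree)⁻¹) = (1 + (Fintype.card 𝔽 : ℝ)⁻¹)⁻¹ := by
    intro P hP
    rw [nonlinDensity, if_pos (Finset.mem_filter.1 hP).2, (Finset.mem_filter.1 hP).2]
    simp
  rw [Finset.prod_congr rfl h1, Finset.prod_const, inv_pow, Real.exp_neg]
  gcongr
  calc (1 + (Fintype.card 𝔽 : ℝ)⁻¹) ^ ((irreds 𝔽 K).filter (·.natDegree = 1)).card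
      ≤ (1 + (Fintype.card 𝔽 : ℝ)⁻¹) ^ Fintype.card 𝔽 := by
        refine pow_le_pow_right₀ ?_ (card_linear_irreds_le K)
        have : (0 : ℝ) ≤ (Fintype.card 𝔽 : ℝ)⁻¹ := by positivity
        linarith
    _ ≤ (Real.exp ((Fintype.card 𝔽 : ℝ)⁻¹)) ^ Fintype.card 𝔽 := by
        gcongr
        linarith [Real.add_one_le_exp ((Fintype.card 𝔽 : ℝ)⁻¹)]
    _ = Real.exp 1 := by
        rw [← Real.exp_nat_mul, mul_inv_cancel₀ hq.ne']

/-- With x = |P|⁻¹ and weight 1/(1+x), the factor is (1+2x)/(1+x)² = 1 - x²/(1+x)² ≥ 1 - x². -/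
theorem sqfreeDensity_le_prod_nonlin (K : ℕ) :
    sqfreeDensity 𝔽 K ≤ ∏ P ∈ nonlinIrreds 𝔽 K,
      (1 + nonlinDensity P * ((Fintype.card 𝔽 : ℝ) ^ P.natDegree)⁻¹) /
        (1 + ((Fintype.card 𝔽 : ℝ) ^ P.natDegree)⁻¹) := by
  have hq1 : (1 : ℝ) ≤ Fintype.card 𝔽 := by exact_mod_cast Fintype.card_pos
  refine Finset.prod_le_prod (fun P _ => ?_) fun P hP => ?_
  · linarith [inv_le_one_of_one_le₀ (one_le_pow₀ hq1 (n := 2 * P.natDegree))]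
  · rw [nonlinIrreds, Finset.mem_filter] at hP
    rw [nonlinDensity, if_neg (by omega), coprimeDensity, pow_mul', ← inv_pow]
    have hx : (0 : ℝ) < ((Fintype.card 𝔽 : ℝ) ^ P.natDegree)⁻¹ := by positivity
    set x := ((Fintype.card 𝔽 : ℝ) ^ P.natDegree)⁻¹
    rw [le_div_iff₀ (by positivity)]
    have h1 : (1 + (1 + x)⁻¹ * x) * (1 + x) = 1 + 2 * x := by field_simp; ring
    refine le_of_mul_le_mul_right ?_ (by positivity : 0 < 1 + x)
    rw [h1]
    nlinarith [mul_pos hx hx, mul_pos (mul_pos hx hx) hx, mul_pos (mul_pos hx hx) (mul_pos hx hx)]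

theorem eighth_le_meanDensity (h4 : 4 ≤ Fintype.card 𝔽) (K : ℕ) : 1 / 8 ≤ meanDensity 𝔽 K := by
  have hq : (4 : ℝ) ≤ Fintype.card 𝔽 := by exact_mod_cast h4
  have h1 : (3 / 4 : ℝ) ≤ 1 - (Fintype.card 𝔽 : ℝ)⁻¹ := by
    have : (Fintype.card 𝔽 : ℝ)⁻¹ ≤ 4⁻¹ := inv_anti₀ (by norm_num) hq
    linarith
  have h2 := exp_neg_one_le_prod_linear (𝔽 := 𝔽) K
  have h3 := (half_le_sqfreeDensity h4 K).trans (sqfreeDensity_le_prod_nonlin K)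
  have h5 : (1 / 3 : ℝ) ≤ Real.exp (-1) := by
    rw [Real.exp_neg, one_div]
    exact inv_anti₀ (Real.exp_pos 1) (by linarith [Real.exp_one_lt_d9])
  rw [meanDensity, irreds_eq_union, Finset.prod_union (disjoint_linear_nonlinIrreds K)]
  calc (1 / 8 : ℝ) = 3 / 4 * (1 / 3 * (1 / 2)) := by norm_num
    _ ≤ _ := by
        have h6 := h5.trans h2
        exact mul_le_mul h1 (mul_le_mul h6 h3 (by norm_num) (by linarith)) (by norm_num)
          (by linarith)

/-- A linear prime, having weight 0, contributes 1 + r/(1-r) = (1-r)⁻¹. For degree p ≥ 2 the weight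
differs from 1 by at most q^(-p), which offsets the number q^p of primes, so these factors
contribute only exp(∑ r^p/(1-r)). -/
theorem prod_error_factor_le {r : ℝ} (hr0 : 0 < r) (hr : r < 1) (K : ℕ) :
    ∏ P ∈ irreds 𝔽 K, (1 + (1 - nonlinDensity P) * (r ^ P.natDegree / (1 - r ^ P.natDegree))) ≤
      ((1 - r)⁻¹) ^ Fintype.card 𝔽 * Real.exp (((1 - r)⁻¹) ^ 2) := by
  have hq : (0 : ℝ) < Fintype.card 𝔽 := by exact_mod_cast Fintype.card_pos
  have h1r : 0 < 1 - r := by linarith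
  have hnn : ∀ P : 𝔽[X], 0 ≤
      1 + (1 - nonlinDensity P) * (r ^ P.natDegree / (1 - r ^ P.natDegree)) := fun P => by
    have h1 : 0 ≤ 1 - nonlinDensity P := by linarith [nonlinDensity_le_one P]
    have h2 : 0 ≤ 1 - r ^ P.natDegree := by linarith [pow_le_one₀ (n := P.natDegree) hr0.le hr.le]
    positivity
  rw [irreds_eq_union, Finset.prod_union (disjoint_linear_nonlinIrreds K)]
  refine mul_le_mul ?_ ?_ (Finset.prod_nonneg fun P _ => hnn P) (by positivity)
  · have h1 : ∀ P ∈ (irreds 𝔽 K).filter (·.natDegree = 1),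
        1 + (1 - nonlinDensity P) * (r ^ P.natDegree / (1 - r ^ P.natDegree)) = (1 - r)⁻¹ := by
      intro P hP
      rw [nonlinDensity, if_pos (Finset.mem_filter.1 hP).2, (Finset.mem_filter.1 hP).2]
      field_simp
      ring
    rw [Finset.prod_congr rfl h1, Finset.prod_const]
    exact pow_le_pow_right₀ ((one_le_inv₀ h1r).2 (by linarith)) (card_linear_irreds_le K)
  · calc ∏ P ∈ nonlinIrreds 𝔽 K,
          (1 + (1 - nonlinDensity P) * (r ^ P.natDegree / (1 - r ^ P.natDegree)))
        ≤ ∏ P ∈ nonlinIrreds 𝔽 K,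
          Real.exp (((Fintype.card 𝔽 : ℝ) ^ P.natDegree)⁻¹ * (r ^ P.natDegree * (1 - r)⁻¹)) := by
          refine Finset.prod_le_prod (fun P _ => hnn P) fun P hP => ?_
          rw [nonlinIrreds, Finset.mem_filter] at hP
          refine le_trans ?_ (Real.add_one_le_exp _)
          rw [add_comm]
          have hx : (0 : ℝ) < ((Fintype.card 𝔽 : ℝ) ^ P.natDegree)⁻¹ := by positivity
          have h1 : 1 - nonlinDensity P ≤ ((Fintype.card 𝔽 : ℝ) ^ P.natDegree)⁻¹ := by
            rw [nonlinDensity, if_neg (by omega), coprimeDensity]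
            set x := ((Fintype.card 𝔽 : ℝ) ^ P.natDegree)⁻¹
            have h3 : 1 - (1 + x)⁻¹ = x / (1 + x) := by field_simp; ring
            rw [h3]
            exact div_le_self hx.le (by linarith)
          have h2 : r ^ P.natDegree ≤ r := by
            simpa using pow_le_pow_of_le_one hr0.le hr.le (show 1 ≤ P.natDegree by omega)
          have h3 : r ^ P.natDegree / (1 - r ^ P.natDegree) ≤ r ^ P.natDegree * (1 - r)⁻¹ := by
            rw [div_eq_mul_inv]
            exact mul_le_mul_of_nonneg_left (inv_anti₀ h1r (by linarith)) (by positivity)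
          have h4 : 0 ≤ 1 - r ^ P.natDegree := by linarith
          linarith [mul_le_mul h1 h3 (by positivity) hx.le]
      _ = Real.exp (∑ P ∈ nonlinIrreds 𝔽 K,
          ((Fintype.card 𝔽 : ℝ) ^ P.natDegree)⁻¹ * (r ^ P.natDegree * (1 - r)⁻¹)) :=
          (Real.exp_sum _ _).symm
      _ ≤ _ := by
          refine Real.exp_le_exp.2 ?_
          refine (sum_natDegree_comp_le (𝔽 := 𝔽) (I := Finset.range (K + 1))
            (f := fun d => ((Fintype.card 𝔽 : ℝ) ^ d)⁻¹ * (r ^ d * (1 - r)⁻¹))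
            (fun P hP => (isPrimeSet_nonlinIrreds K P hP).1)
            (fun P hP => by
              rw [nonlinIrreds, Finset.mem_filter, mem_irreds] at hP
              exact Finset.mem_range.2 (by omega)) fun d => by positivity).trans ?_
          calc _ = ∑ d ∈ Finset.range (K + 1), r ^ d * (1 - r)⁻¹ := by
                refine Finset.sum_congr rfl fun d _ => ?_
                field_simp
            _ ≤ (1 - r)⁻¹ * (1 - r)⁻¹ := by
                rw [← Finset.sum_mul]
                gcongr
                rw [← tsum_geometric_of_lt_one hr0.le hr]
                exact (summable_geometric_of_lt_one hr0.le hr).sum_le_tsum _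
                  fun _ _ => by positivity
            _ = _ := (sq _).symm

theorem abs_sum_prod_coprimeDensity_sub_le {r : ℝ} (hqr : (Fintype.card 𝔽 : ℝ)⁻¹ ≤ r) (hr : r < 1)
    (K : ℕ) {k : ℤ} (hk : k ≤ K) :
    |(∑ T ∈ subsetsOfDeg (nonlinIrreds 𝔽 K) k, ∏ P ∈ T, coprimeDensity P) -
        meanDensity 𝔽 K * (Fintype.card 𝔽 : ℝ) ^ k| ≤
      ((1 - r)⁻¹) ^ Fintype.card 𝔽 * Real.exp (((1 - r)⁻¹) ^ 2) * r ^ (-k) := by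
  have hq1 : (1 : ℝ) < Fintype.card 𝔽 := by exact_mod_cast Fintype.one_lt_card
  have hq0 : (0 : ℝ) < Fintype.card 𝔽 := by linarith
  have hr0 : 0 < r := (inv_pos.2 hq0).trans_le hqr
  have h := abs_weightedSum_sub_le (isPrimeSet_irreds (𝔽 := 𝔽) K) (β := nonlinDensity)
    (c := 1 - (Fintype.card 𝔽 : ℝ)⁻¹) (K := K) hq1 hqr hr nonlinDensity_nonneg
    nonlinDensity_le_one (by linarith [inv_le_one_of_one_le₀ hq1.le])
    (by linarith [inv_pos.2 hq0]) (abs_card_subsetsOfDeg_irreds_sub_le rfl hqr hr K)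
    (Finset.Subset.refl _) k hk
  rw [← weightedSum_nonlinDensity, ← weightedSum_congr (w := fun P =>
    if P ∈ irreds 𝔽 K then nonlinDensity P else 1) fun P hP => if_pos hP]
  refine h.trans ?_
  gcongr
  exact prod_error_factor_le hr0 hr K

end Densities

/-! ### Decomposition of the pairs by character values and roots. -/

section ValueCounts

open scoped Classical

variable {𝔽 : Type*} [Field 𝔽] [Fintype 𝔽]

theorem mulChar_pow_three_eq_one {χ : MulChar 𝔽 ℂ} (hχ : orderOf χ = 3) {y : 𝔽} (hy : y ≠ 0) :
    χ y ^ 3 = 1 := by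
  rw [← MulChar.pow_apply' χ (by norm_num), ← hχ, pow_orderOf_eq_one, MulChar.one_apply hy.isUnit]

/-- Orthogonality of 1, χ and χ²: for y ≠ 0 the sum 1 + χ(y)z² + χ(y)²z is 3 if χ(y) = z and 0
otherwise, while ∑χ and ∑χ² vanish. -/
theorem card_mulChar_fiber {χ : MulChar 𝔽 ℂ} (hχ : orderOf χ = 3) {z : ℂ} (hz : z ^ 3 = 1) :
    ((Finset.univ.filter fun y : 𝔽 => χ y = z).card : ℝ) = ((Fintype.card 𝔽 : ℝ) - 1) / 3 := by
  have hz0 : z ≠ 0 := by rintro rfl; norm_num at hz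
  have h1 : χ ≠ 1 := by rintro rfl; simp at hχ
  have h2 : χ ^ 2 ≠ 1 := fun h => by
    have := orderOf_dvd_of_pow_eq_one h
    rw [hχ] at this; norm_num at this
  have hs1 := MulChar.sum_eq_zero_of_ne_one h1
  have hs2 := MulChar.sum_eq_zero_of_ne_one h2
  have hsum : ∑ y : 𝔽, ((if y = 0 then (0 : ℂ) else 1) + χ y * z ^ 2 + (χ ^ 2) y * z) =
      3 * ((Finset.univ.filter fun y : 𝔽 => χ y = z).card : ℂ) := by
    rw [Finset.card_filter, Nat.cast_sum, Finset.mul_sum]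
    refine Finset.sum_congr rfl fun y _ => ?_
    by_cases hy : y = 0
    · subst hy
      simp [hz0.symm, MulChar.pow_apply' χ (two_ne_zero), MulChar.map_zero]
    · rw [if_neg hy, MulChar.pow_apply' χ two_ne_zero]
      have hy3 := mulChar_pow_three_eq_one hχ hy
      by_cases hyz : χ y = z
      · rw [if_pos hyz, hyz]
        push_cast
        linear_combination 2 * hz
      · rw [if_neg hyz]
        have : (χ y - z) * (1 + χ y * z ^ 2 + χ y ^ 2 * z) = 0 := by
          linear_combination z * hy3 - χ y * hz
        have h5 := (mul_eq_zero.1 this).resolve_left (sub_ne_zero.2 hyz)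
        rw [h5]; simp
  rw [Finset.sum_add_distrib, Finset.sum_add_distrib, ← Finset.sum_mul, ← Finset.sum_mul, hs1, hs2,
    zero_mul, zero_mul, add_zero, add_zero] at hsum
  have hcard : ∑ y : 𝔽, (if y = 0 then (0 : ℂ) else 1) = (Fintype.card 𝔽 : ℂ) - 1 := by
    have : ∀ y : 𝔽, (if y = 0 then (0 : ℂ) else 1) = 1 - if y = 0 then 1 else 0 := fun y => by
      split_ifs <;> simp
    simp [this]
  rw [hcard] at hsum
  have h3 : (Fintype.card 𝔽 : ℝ) - 1 =
      3 * ((Finset.univ.filter fun y : 𝔽 => χ y = z).card : ℝ) := by exact_mod_cast hsum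
  rw [h3]; ring

theorem card_ne_zero_filter :
    ((Finset.univ.filter fun y : 𝔽 => y ≠ 0).card : ℝ) = (Fintype.card 𝔽 : ℝ) - 1 := by
  rw [Finset.filter_ne' Finset.univ (0 : 𝔽), Finset.card_erase_of_mem (Finset.mem_univ _),
    Finset.card_univ, Nat.cast_sub Fintype.card_pos, Nat.cast_one]

/-- The set of linear polynomials `X - C x` with `x ∈ A`. -/
noncomputable def linears (A : Finset 𝔽) : Finset 𝔽[X] := A.image fun x => X - C x

@[simp]
theorem X_sub_C_mem_linears {A : Finset 𝔽} {x : 𝔽} : X - C x ∈ linears A ↔ x ∈ A := by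
  simp [linears]

theorem natDegree_of_mem_linears {A : Finset 𝔽} {P : 𝔽[X]} (hP : P ∈ linears A) :
    P.natDegree = 1 := by
  obtain ⟨x, -, rfl⟩ := Finset.mem_image.1 hP
  exact natDegree_X_sub_C x

theorem degs_linears (A : Finset 𝔽) : degs (linears A) = A.card := by
  rw [degs, Finset.sum_congr rfl fun P hP => natDegree_of_mem_linears hP, Finset.sum_const,
    smul_eq_mul, mul_one, linears, Finset.card_image_of_injective]
  intro x y h
  simpa using h

theorem linears_subset_irreds {K : ℕ} (hK : 1 ≤ K) (A : Finset 𝔽) : linears A ⊆ irreds 𝔽 K := by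
  intro P hP
  obtain ⟨x, -, rfl⟩ := Finset.mem_image.1 hP
  rw [mem_irreds, natDegree_X_sub_C]
  exact ⟨monic_X_sub_C x, hK, irreducible_X_sub_C x⟩

theorem notMem_linears_of_mem_nonlinIrreds {K : ℕ} {A : Finset 𝔽} {P : 𝔽[X]}
    (hP : P ∈ nonlinIrreds 𝔽 K) : P ∉ linears A := fun h => by
  have := natDegree_of_mem_linears h
  rw [nonlinIrreds, Finset.mem_filter] at hP
  omega

theorem X_sub_C_notMem_nonlinIrreds {K : ℕ} (x : 𝔽) : X - C x ∉ nonlinIrreds 𝔽 K := fun h => by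
  rw [nonlinIrreds, Finset.mem_filter, natDegree_X_sub_C] at h
  omega

theorem disjoint_linears {K : ℕ} (A : Finset 𝔽) {S : Finset 𝔽[X]} (hS : S ⊆ nonlinIrreds 𝔽 K) :
    Disjoint (linears A) S :=
  Finset.disjoint_right.2 fun _ hP => notMem_linears_of_mem_nonlinIrreds (hS hP)

theorem IsPrimeSet.eval_prod_eq_zero_iff {S : Finset 𝔽[X]} (hS : IsPrimeSet S) (x : 𝔽) :
    (∏ P ∈ S, P).eval x = 0 ↔ X - C x ∈ S := by
  rw [← hS.dvd_prod_iff (monic_X_sub_C x) (irreducible_X_sub_C x), dvd_iff_isRoot, IsRoot]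

/-- The roots of `∏ P ∈ S, P`. -/
noncomputable def linearRoots (S : Finset 𝔽[X]) : Finset 𝔽 := Finset.univ.filter fun x => X - C x ∈ S

@[simp]
theorem mem_linearRoots {S : Finset 𝔽[X]} {x : 𝔽} : x ∈ linearRoots S ↔ X - C x ∈ S := by
  simp [linearRoots]

theorem linears_linearRoots_union {K : ℕ} {T : Finset 𝔽[X]} (hT : T ⊆ irreds 𝔽 K) :
    linears (linearRoots T) ∪ T ∩ nonlinIrreds 𝔽 K = T := by
  ext P
  rw [Finset.mem_union, Finset.mem_inter]
  constructor
  · rintro (h | h)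
    · obtain ⟨x, hx, rfl⟩ := Finset.mem_image.1 h
      exact mem_linearRoots.1 hx
    · exact h.1
  · intro h
    by_cases hn : P ∈ nonlinIrreds 𝔽 K
    · exact Or.inr ⟨h, hn⟩
    · left
      have h1 := hT h
      have hP := mem_irreds.1 h1
      rw [irreds_eq_union, Finset.mem_union, or_iff_left hn, Finset.mem_filter] at h1
      obtain ⟨x, hx⟩ := exists_root_of_degree_eq_one
        (by rw [degree_eq_natDegree hP.1.ne_zero, h1.2]; rfl)
      have : X - C x = P := eq_of_monic_irreducible_dvd (monic_X_sub_C x) hP.1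
        (irreducible_X_sub_C x) hP.2.2 (dvd_iff_isRoot.2 hx)
      subst this
      rw [X_sub_C_mem_linears, mem_linearRoots]
      exact h

theorem linearRoots_linears_union {K : ℕ} (A : Finset 𝔽) {S : Finset 𝔽[X]}
    (hS : S ⊆ nonlinIrreds 𝔽 K) : linearRoots (linears A ∪ S) = A := by
  ext x
  rw [mem_linearRoots, Finset.mem_union, X_sub_C_mem_linears, or_iff_left]
  exact fun h => X_sub_C_notMem_nonlinIrreds x (hS h)

variable (𝔽) in
/-- The disjoint pairs of sets of primes whose products have degrees `d₁` and `d₂`. -/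
noncomputable def primePairs (K d₁ d₂ : ℕ) : Finset (Finset 𝔽[X] × Finset 𝔽[X]) :=
  (subsetsOfDeg (irreds 𝔽 K) d₁ ×ˢ subsetsOfDeg (irreds 𝔽 K) d₂).filter fun T => Disjoint T.1 T.2

@[simp]
theorem mem_primePairs {K d₁ d₂ : ℕ} {T : Finset 𝔽[X] × Finset 𝔽[X]} :
    T ∈ primePairs 𝔽 K d₁ d₂ ↔ T.1 ⊆ irreds 𝔽 K ∧ degs T.1 = d₁ ∧ T.2 ⊆ irreds 𝔽 K ∧
      degs T.2 = d₂ ∧ Disjoint T.1 T.2 := by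
  simp [primePairs, and_assoc]

/-- The value `χ(F₁ F₂²)` at `x` of a pair of sets of primes. -/
noncomputable def pairValue (χ : MulChar 𝔽 ℂ) (T : Finset 𝔽[X] × Finset 𝔽[X]) (x : 𝔽) : ℂ :=
  χ (((∏ P ∈ T.1, P) * (∏ P ∈ T.2, P) ^ 2).eval x)

theorem pairValue_eq_zero_iff {χ : MulChar 𝔽 ℂ} {T : Finset 𝔽[X] × Finset 𝔽[X]}
    (h₁ : IsPrimeSet T.1) (h₂ : IsPrimeSet T.2) (x : 𝔽) :
    pairValue χ T x = 0 ↔ x ∈ linearRoots T.1 ∨ x ∈ linearRoots T.2 := by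
  rw [mem_linearRoots, mem_linearRoots, ← h₁.eval_prod_eq_zero_iff, ← h₂.eval_prod_eq_zero_iff, pairValue,
    eval_mul, eval_pow]
  constructor
  · intro h
    by_contra! hne
    exact (IsUnit.map χ (mul_ne_zero hne.1 (pow_ne_zero 2 hne.2)).isUnit).ne_zero h
  · rintro (h | h) <;> simp [h, MulChar.map_zero]

/-- The pairs with character values `a` such that `A` is the set of roots of the first component. -/
noncomputable def pairsWithValues (K d₁ d₂ : ℕ) (χ : MulChar 𝔽 ℂ) (a : 𝔽 → ℂ) (A : Finset 𝔽) :
    Finset (Finset 𝔽[X] × Finset 𝔽[X]) :=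
  (primePairs 𝔽 K d₁ d₂).filter fun T => pairValue χ T = a ∧ linearRoots T.1 = A

/-- The factor of `F₁ F₂²` that remains when the primes of `F₁` of degree at least `2` are
removed. -/
noncomputable def cofactor (a : 𝔽 → ℂ) (A : Finset 𝔽) (S₂ : Finset 𝔽[X]) : 𝔽[X] :=
  (∏ P ∈ linears A, P) * (∏ P ∈ linears (Finset.univ.filter (a · = 0) \ A) ∪ S₂, P) ^ 2

/-- Once a and A are fixed, the linear primes of both components are forced (A for the first, the
other zeros of a for the second). What is left is the nonlinear parts S₁ and S₂, and the conditions
at zeros of a hold automatically. -/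
theorem card_pairsWithValues {K d₁ d₂ : ℕ} (hK : 1 ≤ K) (χ : MulChar 𝔽 ℂ) (a : 𝔽 → ℂ)
    (A : Finset 𝔽) :
    (pairsWithValues K d₁ d₂ χ a A).card =
      ∑ S₂ ∈ subsetsOfDeg (nonlinIrreds 𝔽 K)
        ((d₂ : ℤ) - (Finset.univ.filter (a · = 0) \ A).card),
      ((subsetsOfDeg (nonlinIrreds 𝔽 K \ S₂) ((d₁ : ℤ) - A.card)).filter fun S₁ =>
        ∀ x, a x ≠ 0 → χ ((cofactor a A S₂).eval x) * χ ((∏ P ∈ S₁, P).eval x) = a x).card := by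
  obtain ⟨Z, hZ⟩ : ∃ Z, Z = Finset.univ.filter (a · = 0) := ⟨_, rfl⟩
  rw [← hZ]
  have hmemZ : ∀ x, x ∈ Z ↔ a x = 0 := fun x => by simp [hZ]
  rw [← Finset.card_sigma]
  symm
  have hval : ∀ S₁ S₂ : Finset 𝔽[X], S₁ ⊆ nonlinIrreds 𝔽 K → ∀ x,
      pairValue χ (linears A ∪ S₁, linears (Z \ A) ∪ S₂) x =
        χ ((cofactor a A S₂).eval x) * χ ((∏ P ∈ S₁, P).eval x) := by
    intro S₁ S₂ h₁ x
    rw [pairValue, Finset.prod_union (disjoint_linears A h₁), ← map_mul, ← eval_mul, cofactor, ← hZ,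
      mul_right_comm]
  refine Finset.card_bij (fun S _ => (linears A ∪ S.2, linears (Z \ A) ∪ S.1)) ?_ ?_ ?_
  · rintro ⟨S₂, S₁⟩ hS
    simp only [Finset.mem_sigma, Finset.mem_filter, mem_subsetsOfDeg] at hS
    obtain ⟨⟨h1, h2⟩, ⟨h3, h4⟩, h5⟩ := hS
    have h3' := h3.trans Finset.sdiff_subset
    have hsub1 : linears A ∪ S₁ ⊆ irreds 𝔽 K :=
      Finset.union_subset (linears_subset_irreds hK A) (h3'.trans (nonlinIrreds_subset K))
    have hsub2 : linears (Z \ A) ∪ S₂ ⊆ irreds 𝔽 K :=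
      Finset.union_subset (linears_subset_irreds hK _) (h1.trans (nonlinIrreds_subset K))
    simp only [pairsWithValues, Finset.mem_filter, mem_primePairs]
    refine ⟨⟨hsub1, ?_, hsub2, ?_, ?_⟩, ?_, linearRoots_linears_union A h3'⟩
    · rw [degs_union (disjoint_linears A h3'), degs_linears]; omega
    · rw [degs_union (disjoint_linears _ h1), degs_linears]; omega
    · rw [Finset.disjoint_union_left, Finset.disjoint_union_right, Finset.disjoint_union_right]
      refine ⟨⟨?_, disjoint_linears A h1⟩, (disjoint_linears _ h3').symm, ?_⟩
      · rw [Finset.disjoint_left]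
        intro P hP hP'
        obtain ⟨x, hx, rfl⟩ := Finset.mem_image.1 hP
        rw [X_sub_C_mem_linears] at hP'
        exact (Finset.mem_sdiff.1 hP').2 hx
      · exact (Finset.disjoint_of_subset_left h3 Finset.sdiff_disjoint)
    · funext x
      by_cases hx : a x = 0
      · rw [hx, pairValue_eq_zero_iff ((isPrimeSet_irreds K).mono hsub1)
          ((isPrimeSet_irreds K).mono hsub2), linearRoots_linears_union A h3',
          linearRoots_linears_union _ h1, Finset.mem_sdiff, hmemZ]
        tauto
      · rw [hval S₁ S₂ h3', h5 x hx]
  · rintro ⟨S₂, S₁⟩ hS ⟨S₂', S₁'⟩ hS' he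
    simp only [Finset.mem_sigma, Finset.mem_filter, mem_subsetsOfDeg] at hS hS'
    simp only [Prod.mk.injEq] at he
    have hcancel : ∀ {B : Finset 𝔽} {S S' : Finset 𝔽[X]}, S ⊆ nonlinIrreds 𝔽 K →
        S' ⊆ nonlinIrreds 𝔽 K → linears B ∪ S = linears B ∪ S' → S = S' := by
      intro B S S' h h' he
      rw [← Finset.union_sdiff_cancel_left (disjoint_linears B h), he,
        Finset.union_sdiff_cancel_left (disjoint_linears B h')]
    obtain rfl := hcancel hS.1.1 hS'.1.1 he.2
    obtain rfl := hcancel (hS.2.1.1.trans Finset.sdiff_subset)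
      (hS'.2.1.1.trans Finset.sdiff_subset) he.1
    rfl
  · rintro ⟨T₁, T₂⟩ hT
    simp only [pairsWithValues, Finset.mem_filter, mem_primePairs] at hT
    obtain ⟨⟨h1, h2, h3, h4, h5⟩, h6, h7⟩ := hT
    have hp1 := (isPrimeSet_irreds K).mono h1
    have hp2 := (isPrimeSet_irreds K).mono h3
    have hr2 : linearRoots T₂ = Z \ A := by
      ext x
      have h8 := pairValue_eq_zero_iff (χ := χ) (T := (T₁, T₂)) hp1 hp2 x
      rw [h6, h7] at h8
      rw [Finset.mem_sdiff, hmemZ, h8]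
      constructor
      · intro h
        refine ⟨Or.inr h, fun hxA => ?_⟩
        rw [← h7, mem_linearRoots] at hxA
        rw [mem_linearRoots] at h
        exact Finset.disjoint_left.1 h5 hxA h
      · rintro ⟨h | h, h'⟩
        · exact absurd h h'
        · exact h
    have hT1 := linears_linearRoots_union h1
    have hT2 := linears_linearRoots_union h3
    rw [h7] at hT1
    rw [hr2] at hT2
    have hd1 := degs_union (disjoint_linears A
      (Finset.inter_subset_right (s₁ := T₁) (s₂ := nonlinIrreds 𝔽 K)))
    have hd2 := degs_union (disjoint_linears (Z \ A)
      (Finset.inter_subset_right (s₁ := T₂) (s₂ := nonlinIrreds 𝔽 K)))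
    rw [hT1, degs_linears] at hd1
    rw [hT2, degs_linears] at hd2
    refine ⟨⟨T₂ ∩ nonlinIrreds 𝔽 K, T₁ ∩ nonlinIrreds 𝔽 K⟩, ?_, by simp only [hT1, hT2]⟩
    simp only [Finset.mem_sigma, Finset.mem_filter, mem_subsetsOfDeg]
    refine ⟨⟨Finset.inter_subset_right, by omega⟩, ⟨?_, by omega⟩, fun x _ => ?_⟩
    · intro P hP
      rw [Finset.mem_inter] at hP
      refine Finset.mem_sdiff.2 ⟨hP.2, fun h => ?_⟩
      exact Finset.disjoint_left.1 h5 hP.1 (Finset.mem_inter.1 h).1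
    · rw [← hval _ _ Finset.inter_subset_right, hT1, hT2, h6]

theorem cofactor_eval_ne_zero {K : ℕ} {a : 𝔽 → ℂ} {A : Finset 𝔽} (hK : 1 ≤ K)
    (hA : A ⊆ Finset.univ.filter (a · = 0)) {S₂ : Finset 𝔽[X]} (hS₂ : S₂ ⊆ nonlinIrreds 𝔽 K)
    {x : 𝔽} (hx : a x ≠ 0) : (cofactor a A S₂).eval x ≠ 0 := by
  have hp1 := (isPrimeSet_irreds K).mono (linears_subset_irreds hK A)
  have hp2 := (isPrimeSet_irreds K).mono (Finset.union_subset
    (linears_subset_irreds hK (Finset.univ.filter (a · = 0) \ A))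
    (hS₂.trans (nonlinIrreds_subset K)))
  rw [cofactor, eval_mul, eval_pow]
  refine mul_ne_zero ?_ (pow_ne_zero 2 ?_)
  · rw [Ne, hp1.eval_prod_eq_zero_iff, X_sub_C_mem_linears]
    intro h
    exact hx (by simpa using hA h)
  · rw [Ne, hp2.eval_prod_eq_zero_iff, Finset.mem_union, X_sub_C_mem_linears, Finset.mem_sdiff]
    rintro (h | h)
    · exact hx (by simpa using h.1)
    · exact X_sub_C_notMem_nonlinIrreds x (hS₂ h)

/-- The number of residues of `G ∈ 𝔽[X]` modulo `X ^ q - X` that are compatible with the character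
values `a` once the roots are prescribed. -/
noncomputable def residueCount (a : 𝔽 → ℂ) : ℝ :=
  ∏ x : 𝔽, if a x = 0 then (Fintype.card 𝔽 : ℝ) - 1 else ((Fintype.card 𝔽 : ℝ) - 1) / 3

/-- At a zero of a any nonzero value is allowed. Elsewhere χ(y) must be a(x)/χ(g(x)), a cube root of
unity, so the number of choices does not depend on g; this makes the count uniform in F₂ and A. -/
theorem card_residues {χ : MulChar 𝔽 ℂ} (hχ : orderOf χ = 3) {a : 𝔽 → ℂ}
    (ha : ∀ x, a x = 0 ∨ a x ^ 3 = 1) {g : 𝔽 → 𝔽} (hg : ∀ x, a x ≠ 0 → g x ≠ 0) :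
    ((Fintype.piFinset fun x => Finset.univ.filter fun y : 𝔽 =>
      y ≠ 0 ∧ (a x ≠ 0 → χ (g x) * χ y = a x)).card : ℝ) = residueCount a := by
  rw [Fintype.card_piFinset, Nat.cast_prod, residueCount]
  refine Finset.prod_congr rfl fun x _ => ?_
  by_cases hx : a x = 0
  · rw [if_pos hx, ← card_ne_zero_filter]
    simp [hx]
  · have hg3 := mulChar_pow_three_eq_one hχ (hg x hx)
    have ha3 := (ha x).resolve_left hx
    -- χ(g(x))² is the inverse of χ(g(x)).
    have hz : (a x * χ (g x) ^ 2) ^ 3 = 1 := by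
      rw [mul_pow, ← pow_mul, mul_comm 2 3, pow_mul, hg3, ha3]; norm_num
    rw [if_neg hx, ← card_mulChar_fiber hχ hz]
    congr 2
    ext y
    simp only [Finset.mem_filter, Finset.mem_univ, true_and]
    constructor
    · rintro ⟨-, h⟩
      rw [← h hx]
      linear_combination -χ y * hg3
    · intro h
      refine ⟨?_, fun _ => ?_⟩
      · rintro rfl
        rw [MulChar.map_zero] at h
        rw [← h] at hz
        norm_num at hz
      · rw [h]
        linear_combination a x * hg3

theorem card_filter_values {K : ℕ} {χ : MulChar 𝔽 ℂ} (a : 𝔽 → ℂ) (g : 𝔽 → 𝔽) (S₂ : Finset 𝔽[X])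
    (n : ℤ) :
    ((subsetsOfDeg (nonlinIrreds 𝔽 K \ S₂) n).filter fun S₁ =>
        ∀ x, a x ≠ 0 → χ (g x) * χ ((∏ P ∈ S₁, P).eval x) = a x).card =
      ∑ b ∈ Fintype.piFinset fun x => Finset.univ.filter fun y : 𝔽 =>
        y ≠ 0 ∧ (a x ≠ 0 → χ (g x) * χ y = a x), (classSubsets K S₂ n b).card := by
  have hmaps : ∀ S₁ ∈ (subsetsOfDeg (nonlinIrreds 𝔽 K \ S₂) n).filter fun S₁ =>
        ∀ x, a x ≠ 0 → χ (g x) * χ ((∏ P ∈ S₁, P).eval x) = a x,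
      (fun x => (∏ P ∈ S₁, P).eval x) ∈ Fintype.piFinset fun x => Finset.univ.filter fun y : 𝔽 =>
        y ≠ 0 ∧ (a x ≠ 0 → χ (g x) * χ y = a x) := by
    intro S₁ hS₁
    simp only [Finset.mem_filter, mem_subsetsOfDeg] at hS₁
    rw [Fintype.mem_piFinset]
    intro x
    rw [Finset.mem_filter]
    refine ⟨Finset.mem_univ _, ?_, hS₁.2 x⟩
    rw [eval_prod]
    exact Finset.prod_ne_zero_iff.2 fun P hP =>
      eval_ne_zero_of_mem_nonlinIrreds ((hS₁.1.1.trans Finset.sdiff_subset) hP) x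
  rw [Finset.card_eq_sum_card_fiberwise hmaps]
  refine Finset.sum_congr rfl fun b hb => ?_
  congr 1
  ext S₁
  simp only [classSubsets, Finset.mem_filter]
  rw [Fintype.mem_piFinset] at hb
  constructor
  · rintro ⟨⟨h1, -⟩, h2⟩
    exact ⟨h1, fun x => congrFun h2 x⟩
  · rintro ⟨h1, h2⟩
    refine ⟨⟨h1, fun x hx => ?_⟩, funext h2⟩
    rw [h2]
    exact (Finset.mem_filter.1 (hb x)).2.2 hx

end ValueCounts

/-! ### Pairs with prescribed character values: main term and relative error. -/

section PairEstimates

open scoped Classical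

variable {𝔽 : Type*} [Field 𝔽] [Fintype 𝔽]

theorem residueCount_nonneg (a : 𝔽 → ℂ) : 0 ≤ residueCount a := by
  have hq1 : (1 : ℝ) ≤ Fintype.card 𝔽 := by exact_mod_cast Fintype.card_pos
  refine Finset.prod_nonneg fun x _ => ?_
  split_ifs <;> linarith

theorem card_pairsWithValues_eq_sum {K d₁ d₂ : ℕ} (hK : 1 ≤ K) (χ : MulChar 𝔽 ℂ) (a : 𝔽 → ℂ)
    (A : Finset 𝔽) :
    ((pairsWithValues K d₁ d₂ χ a A).card : ℝ) =
      ∑ S₂ ∈ subsetsOfDeg (nonlinIrreds 𝔽 K)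
        ((d₂ : ℤ) - (Finset.univ.filter (a · = 0) \ A).card),
      ∑ b ∈ Fintype.piFinset fun x => Finset.univ.filter fun y : 𝔽 =>
        y ≠ 0 ∧ (a x ≠ 0 → χ ((cofactor a A S₂).eval x) * χ y = a x),
        ((classSubsets K S₂ ((d₁ : ℤ) - A.card) b).card : ℝ) := by
  rw [card_pairsWithValues hK, Nat.cast_sum]
  refine Finset.sum_congr rfl fun S₂ _ => ?_
  rw [card_filter_values a (fun x => (cofactor a A S₂).eval x), Nat.cast_sum]

/-- The first error is the sieve error summed over b and averaged over S₂ (8 = 4·2, by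
`sum_sum_powerset_zpow_neg_le`). The second comes from replacing the average of the coprimality
densities over S₂ by its main term. -/
theorem abs_card_pairsWithValues_sub_le {K d₁ d₂ : ℕ} (hK : 1 ≤ K) (h₁ : d₁ ≤ K) (h₂ : d₂ ≤ K)
    {χ : MulChar 𝔽 ℂ} (hχ : orderOf χ = 3) {a : 𝔽 → ℂ} (ha : ∀ x, a x = 0 ∨ a x ^ 3 = 1)
    {A : Finset 𝔽} (hA : A ⊆ Finset.univ.filter (a · = 0)) {t r : ℝ} (ht : 2 ≤ t)
    (htq : t ^ 2 = Fintype.card 𝔽) (hqr : (Fintype.card 𝔽 : ℝ)⁻¹ ≤ r) (hr : r < 1) {n k : ℤ}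
    (hn : n = (d₁ : ℤ) - A.card)
    (hk : k = (d₂ : ℤ) - (Finset.univ.filter (a · = 0) \ A).card) :
    |((pairsWithValues K d₁ d₂ χ a A).card : ℝ) -
        residueCount a * ((Fintype.card 𝔽 : ℝ) ^ (n - (Fintype.card 𝔽 : ℤ)) * sqfreeDensity 𝔽 K *
          (meanDensity 𝔽 K * (Fintype.card 𝔽 : ℝ) ^ k))| ≤
      residueCount a * (8 * t ^ n * (Fintype.card 𝔽 : ℝ) ^ k +
        (Fintype.card 𝔽 : ℝ) ^ (n - (Fintype.card 𝔽 : ℤ)) * sqfreeDensity 𝔽 K *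
          (((1 - r)⁻¹) ^ Fintype.card 𝔽 * Real.exp (((1 - r)⁻¹) ^ 2) * r ^ (-k))) := by
  have hR := residueCount_nonneg a
  rw [card_pairsWithValues_eq_sum hK, ← hn, ← hk]
  have hq0 : (0 : ℝ) < Fintype.card 𝔽 := by exact_mod_cast Fintype.card_pos
  have ht0 : 0 < t := by linarith
  set M : ℝ := (Fintype.card 𝔽 : ℝ) ^ (n - (Fintype.card 𝔽 : ℤ)) * sqfreeDensity 𝔽 K with hM
  have hM0 : 0 ≤ M := by
    refine mul_nonneg (by positivity) (Finset.prod_nonneg fun P _ => ?_)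
    have hq1 : (1 : ℝ) ≤ Fintype.card 𝔽 := by exact_mod_cast Fintype.card_pos
    linarith [inv_le_one_of_one_le₀ (one_le_pow₀ hq1 (n := 2 * P.natDegree))]
  have hinner : ∀ S₂ ∈ subsetsOfDeg (nonlinIrreds 𝔽 K) k,
      |(∑ b ∈ Fintype.piFinset fun x => Finset.univ.filter fun y : 𝔽 =>
        y ≠ 0 ∧ (a x ≠ 0 → χ ((cofactor a A S₂).eval x) * χ y = a x),
        ((classSubsets K S₂ n b).card : ℝ)) - residueCount a * (M * ∏ P ∈ S₂, coprimeDensity P)| ≤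
      residueCount a * (4 * t ^ n * ∑ E ∈ S₂.powerset, t ^ (-(degs E : ℤ))) := by
    intro S₂ hS₂
    have hS₂' := (mem_subsetsOfDeg.1 hS₂).1
    rw [← card_residues hχ ha fun x hx => cofactor_eval_ne_zero hK hA hS₂' hx, ← nsmul_eq_mul,
      ← nsmul_eq_mul, ← Finset.sum_const, ← Finset.sum_const, ← Finset.sum_sub_distrib]
    refine (Finset.abs_sum_le_sum_abs _ _).trans (Finset.sum_le_sum fun b hb => ?_)
    rw [Fintype.mem_piFinset] at hb
    rw [hM, mul_assoc ((Fintype.card 𝔽 : ℝ) ^ (n - (Fintype.card 𝔽 : ℤ)))]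
    exact abs_card_classSubsets_sub_le hS₂' (by omega)
      (fun x => (Finset.mem_filter.1 (hb x)).2.1) ht htq
  have houter := abs_sum_prod_coprimeDensity_sub_le hqr hr K (k := k) (by omega)
  set V := ∑ T ∈ subsetsOfDeg (nonlinIrreds 𝔽 K) k, ∏ P ∈ T, coprimeDensity P with hV
  have h1 : |(∑ S₂ ∈ subsetsOfDeg (nonlinIrreds 𝔽 K) k,
      ∑ b ∈ Fintype.piFinset fun x => Finset.univ.filter fun y : 𝔽 =>
        y ≠ 0 ∧ (a x ≠ 0 → χ ((cofactor a A S₂).eval x) * χ y = a x),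
        ((classSubsets K S₂ n b).card : ℝ)) - residueCount a * (M * V)| ≤
      residueCount a * (8 * t ^ n * (Fintype.card 𝔽 : ℝ) ^ k) := by
    rw [hV, Finset.mul_sum, Finset.mul_sum, ← Finset.sum_sub_distrib]
    refine (Finset.abs_sum_le_sum_abs _ _).trans ((Finset.sum_le_sum hinner).trans ?_)
    rw [← Finset.mul_sum, ← Finset.mul_sum]
    refine mul_le_mul_of_nonneg_left ?_ hR
    have := sum_sum_powerset_zpow_neg_le (isPrimeSet_nonlinIrreds (𝔽 := 𝔽) K) ht htq k
    calc _ ≤ 4 * t ^ n * (2 * (Fintype.card 𝔽 : ℝ) ^ k) := by gcongr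
      _ = _ := by ring
  have h2 : |residueCount a * (M * V) -
      residueCount a * (M * (meanDensity 𝔽 K * (Fintype.card 𝔽 : ℝ) ^ k))| ≤
      residueCount a * (M *
        (((1 - r)⁻¹) ^ Fintype.card 𝔽 * Real.exp (((1 - r)⁻¹) ^ 2) * r ^ (-k))) := by
    rw [← mul_sub, ← mul_sub, abs_mul, abs_mul, abs_of_nonneg hR, abs_of_nonneg hM0]
    gcongr
  rw [mul_add]
  refine le_trans ?_ (add_le_add h1 h2)
  exact abs_sub_le _ _ _

/-- The relative error in the count of pairs with prescribed character values. -/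
theorem abs_card_pairsWithValues_sub_le' {K d₁ d₂ : ℕ} (hK : 1 ≤ K) (h₁ : d₁ ≤ K) (h₂ : d₂ ≤ K)
    (h4 : 4 ≤ Fintype.card 𝔽)
    {χ : MulChar 𝔽 ℂ} (hχ : orderOf χ = 3) {a : 𝔽 → ℂ} (ha : ∀ x, a x = 0 ∨ a x ^ 3 = 1)
    {A : Finset 𝔽} (hA : A ⊆ Finset.univ.filter (a · = 0)) {t r : ℝ} (ht : 2 ≤ t)
    (htq : t ^ 2 = Fintype.card 𝔽) (hqr : (Fintype.card 𝔽 : ℝ)⁻¹ ≤ r) (hr : r < 1) {W η : ℝ}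
    (hW : W = sqfreeDensity 𝔽 K * meanDensity 𝔽 K *
      (Fintype.card 𝔽 : ℝ) ^ ((d₁ : ℤ) + d₂ - Fintype.card 𝔽))
    (hη : η = 128 * t ^ (3 * (Fintype.card 𝔽 : ℤ) - d₁) +
      8 * (((1 - r)⁻¹) ^ Fintype.card 𝔽 * Real.exp (((1 - r)⁻¹) ^ 2)) *
        (r * Fintype.card 𝔽) ^ ((Fintype.card 𝔽 : ℤ) - d₂)) :
    |((pairsWithValues K d₁ d₂ χ a A).card : ℝ) -
        W * (residueCount a * (Fintype.card 𝔽 : ℝ) ^ (-((Finset.univ.filter (a · = 0)).card : ℤ)))| ≤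
      W * (residueCount a * (Fintype.card 𝔽 : ℝ) ^ (-((Finset.univ.filter (a · = 0)).card : ℤ))) *
        η := by
  have hmain := abs_card_pairsWithValues_sub_le hK h₁ h₂ hχ ha hA ht htq hqr hr rfl rfl
  have hR := residueCount_nonneg a
  have hκ := half_le_sqfreeDensity (𝔽 := 𝔽) h4 K
  have hc := eighth_le_meanDensity (𝔽 := 𝔽) h4 K
  have hcardA : A.card + (Finset.univ.filter (a · = 0) \ A).card =
      (Finset.univ.filter (a · = 0)).card := by
    rw [add_comm]; exact Finset.card_sdiff_add_card_eq_card hA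
  have hAq : A.card ≤ Fintype.card 𝔽 := Finset.card_le_univ A
  have hBq : (Finset.univ.filter (a · = 0) \ A).card ≤ Fintype.card 𝔽 := Finset.card_le_univ _
  set κ := sqfreeDensity 𝔽 K
  set c := meanDensity 𝔽 K
  set m := (Finset.univ.filter (a · = 0)).card
  set m₁ := A.card
  set m₂ := (Finset.univ.filter (a · = 0) \ A).card
  set N := Fintype.card 𝔽
  set B := ((1 - r)⁻¹) ^ N * Real.exp (((1 - r)⁻¹) ^ 2)
  set R := residueCount a
  have hN : (4 : ℝ) ≤ N := by exact_mod_cast h4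
  have hN0 : (N : ℝ) ≠ 0 := by positivity
  have ht0 : t ≠ 0 := by positivity
  have hr0 : 0 < r := (inv_pos.2 (by linarith)).trans_le hqr
  have hB : 0 ≤ B := by
    have : 0 < 1 - r := by linarith
    positivity
  have hpow : (N : ℝ) ^ ((d₁ : ℤ) - m₁ - N) * (N : ℝ) ^ ((d₂ : ℤ) - m₂) =
      (N : ℝ) ^ ((d₁ : ℤ) + d₂ - N) * (N : ℝ) ^ (-(m : ℤ)) := by
    rw [← zpow_add₀ hN0, ← zpow_add₀ hN0, ← hcardA]
    congr 1; push_cast; ring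
  set Q := (N : ℝ) ^ ((d₁ : ℤ) + d₂ - N) * (N : ℝ) ^ (-(m : ℤ)) with hQ
  have hQ0 : 0 < Q := by positivity
  have e1 : R * ((N : ℝ) ^ ((d₁ : ℤ) - m₁ - N) * κ * (c * (N : ℝ) ^ ((d₂ : ℤ) - m₂))) =
      W * (R * (N : ℝ) ^ (-(m : ℤ))) := by
    rw [hW]
    linear_combination R * κ * c * hpow
  rw [e1] at hmain
  refine hmain.trans ?_
  have e2 : W * (R * (N : ℝ) ^ (-(m : ℤ))) * η = R * (Q * (κ * c * η)) := by
    rw [hW, hQ]; ring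
  rw [e2]
  refine mul_le_mul_of_nonneg_left ?_ hR
  -- In powers of t the right side exceeds the left by q - m₁ ≥ 0: the q residues cost q^q = t^(2q),
  -- and up to q roots of the first factor cost the rest of t^(3q).
  have b1 : 8 * t ^ ((d₁ : ℤ) - m₁) * (N : ℝ) ^ ((d₂ : ℤ) - m₂) ≤
      Q * (8 * t ^ (3 * (N : ℤ) - d₁)) := by
    have : t ^ ((d₁ : ℤ) - m₁) ≤ (N : ℝ) ^ ((d₁ : ℤ) - m₁ - N) * t ^ (3 * (N : ℤ) - d₁) := by
      rw [← htq, ← zpow_natCast t 2, ← zpow_mul, ← zpow_add₀ ht0]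
      exact zpow_le_zpow_right₀ (by linarith) (by push_cast; omega)
    rw [← hpow]
    calc _ ≤ 8 * ((N : ℝ) ^ ((d₁ : ℤ) - m₁ - N) * t ^ (3 * (N : ℤ) - d₁)) *
          (N : ℝ) ^ ((d₂ : ℤ) - m₂) := by gcongr
      _ = _ := by ring
  have b2 : (N : ℝ) ^ ((d₁ : ℤ) - m₁ - N) * κ * (B * r ^ (-((d₂ : ℤ) - m₂))) ≤
      Q * (κ * (B * (r * N) ^ ((N : ℤ) - d₂))) := by
    have hrN : 1 ≤ r * N := by
      have := mul_le_mul_of_nonneg_right hqr (by linarith : (0 : ℝ) ≤ N)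
      rwa [inv_mul_cancel₀ hN0] at this
    -- Since rq ≥ 1 and m₂ ≤ q, the number of roots of the second factor may be replaced by q,
    -- making the error independent of A and a.
    have : r ^ (-((d₂ : ℤ) - m₂)) ≤ (N : ℝ) ^ ((d₂ : ℤ) - m₂) * (r * N) ^ ((N : ℤ) - d₂) := by
      calc r ^ (-((d₂ : ℤ) - m₂)) =
          (N : ℝ) ^ ((d₂ : ℤ) - m₂) * (r * N) ^ (-((d₂ : ℤ) - m₂)) := by
            rw [mul_zpow, mul_left_comm, ← zpow_add₀ hN0, add_neg_cancel, zpow_zero, mul_one]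
        _ ≤ _ := by
            gcongr
            omega
    rw [← hpow]
    calc _ ≤ (N : ℝ) ^ ((d₁ : ℤ) - m₁ - N) * κ *
          (B * ((N : ℝ) ^ ((d₂ : ℤ) - m₂) * (r * N) ^ ((N : ℤ) - d₂))) := by gcongr
      _ = _ := by ring
  refine (add_le_add b1 b2).trans ?_
  rw [← mul_add]
  refine mul_le_mul_of_nonneg_left ?_ hQ0.le
  rw [hη]
  have p1 : 0 < t ^ (3 * (N : ℤ) - d₁) := by positivity
  have p2 : 0 ≤ B * (r * N) ^ ((N : ℤ) - d₂) := by positivity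
  -- From κ ≥ 1/2 and c ≥ 1/8. Dividing by κc turns the factor 8 into 128; the second error already
  -- carries κ, so it only loses 8.
  have q1 : 1 / 16 ≤ κ * c := by nlinarith
  have q2 : κ * (1 / 8) ≤ κ * c := by nlinarith
  have i1 := mul_le_mul_of_nonneg_right q1 p1.le
  have i2 := mul_le_mul_of_nonneg_right q2 p2
  nlinarith

end PairEstimates

/-! ### The family as a set of pairs, and a lower bound for its size. -/

section FamilyCounts

open scoped Classical

variable {𝔽 : Type*} [Field 𝔽] [Fintype 𝔽]

theorem card_filter_mem_subsetsOfDeg_le {S : Finset 𝔽[X]} (hS : IsPrimeSet S) (P : 𝔽[X]) (k : ℤ) :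
    (((subsetsOfDeg S k).filter (P ∈ ·)).card : ℝ) ≤ (Fintype.card 𝔽 : ℝ) ^ (k - P.natDegree) := by
  refine le_trans ?_ (card_subsetsOfDeg_le hS (k - P.natDegree))
  norm_cast
  refine Finset.card_le_card_of_injOn (·.erase P) ?_ ?_
  · intro T hT
    simp only [Finset.coe_filter, mem_subsetsOfDeg, Set.mem_ofPred_eq, Finset.mem_coe] at hT ⊢
    refine ⟨(Finset.erase_subset _ _).trans hT.1.1, ?_⟩
    have : degs (T.erase P) + P.natDegree = degs T := Finset.sum_erase_add _ _ hT.2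
    omega
  · intro T hT U hU h
    simp only [Finset.coe_filter, mem_subsetsOfDeg, Set.mem_ofPred_eq] at hT hU h
    rw [← Finset.insert_erase hT.2, h, Finset.insert_erase hU.2]

theorem le_card_subsetsOfDeg_irreds {K d : ℕ} (hd : d ≤ K) :
    (1 - (Fintype.card 𝔽 : ℝ)⁻¹) * (Fintype.card 𝔽 : ℝ) ^ d ≤
      ((subsetsOfDeg (irreds 𝔽 K) d).card : ℝ) := by
  rw [card_subsetsOfDeg_irreds hd]
  have hq0 : (0 : ℝ) < Fintype.card 𝔽 := by exact_mod_cast Fintype.card_pos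
  have hlow : ∀ n < 2, (1 - (Fintype.card 𝔽 : ℝ)⁻¹) * (Fintype.card 𝔽 : ℝ) ^ n ≤
      ((sqfreeMonics 𝔽 n).card : ℝ) := by
    intro n hn
    rw [card_sqfreeMonics_of_lt_two hn]
    push_cast
    exact mul_le_of_le_one_left (by positivity) (by linarith [inv_pos.2 hq0])
  match d with
  | 0 => exact hlow 0 (by norm_num)
  | 1 => exact hlow 1 (by norm_num)
  | n + 2 =>
    have h := congrArg (Nat.cast : ℕ → ℝ) (card_sqfreeMonics_add_two (𝔽 := 𝔽) n)
    push_cast at h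
    have : (Fintype.card 𝔽 : ℝ)⁻¹ * (Fintype.card 𝔽 : ℝ) ^ (n + 2) =
        (Fintype.card 𝔽 : ℝ) ^ (n + 1) := by field_simp; ring
    linarith

/-- There are at least (3/4)² q^(d₁+d₂) pairs of square-free polynomials. Those sharing a prime P
number at most q^(d₁+d₂-2 deg P), altogether at most ∑ 4^(-d) = 1/3 of q^(d₁+d₂), and 9/16 - 1/3 >
1/5. -/
theorem fifth_le_card_primePairs {K d₁ d₂ : ℕ} (h₁ : d₁ ≤ K) (h₂ : d₂ ≤ K)
    (h4 : 4 ≤ Fintype.card 𝔽) :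
    1 / 5 * (Fintype.card 𝔽 : ℝ) ^ (d₁ + d₂) ≤ ((primePairs 𝔽 K d₁ d₂).card : ℝ) := by
  have hq : (4 : ℝ) ≤ Fintype.card 𝔽 := by exact_mod_cast h4
  have hq0 : (Fintype.card 𝔽 : ℝ) ≠ 0 := by positivity
  set N : ℝ := (Fintype.card 𝔽 : ℝ) with hN
  have hinv : N⁻¹ ≤ 1 / 4 := by
    rw [one_div]; exact inv_anti₀ (by norm_num) hq
  have hall := Finset.card_filter_add_card_filter_not (s := subsetsOfDeg (irreds 𝔽 K) d₁ ×ˢ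
    subsetsOfDeg (irreds 𝔽 K) d₂) fun T => Disjoint T.1 T.2
  rw [Finset.card_product] at hall
  have hall' := congrArg (Nat.cast : ℕ → ℝ) hall
  push_cast at hall'
  have hbad : ((subsetsOfDeg (irreds 𝔽 K) d₁ ×ˢ subsetsOfDeg (irreds 𝔽 K) d₂).filter
      fun T => ¬ Disjoint T.1 T.2) ⊆ (irreds 𝔽 K).biUnion fun P =>
      (subsetsOfDeg (irreds 𝔽 K) d₁).filter (P ∈ ·) ×ˢ
        (subsetsOfDeg (irreds 𝔽 K) d₂).filter (P ∈ ·) := by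
    rintro ⟨T₁, T₂⟩ hT
    rw [Finset.mem_filter, Finset.mem_product, Finset.not_disjoint_iff] at hT
    obtain ⟨⟨hT1, hT2⟩, P, hP1, hP2⟩ := hT
    rw [Finset.mem_biUnion]
    refine ⟨P, (mem_subsetsOfDeg.1 hT1).1 hP1, ?_⟩
    rw [Finset.mem_product, Finset.mem_filter, Finset.mem_filter]
    exact ⟨⟨hT1, hP1⟩, hT2, hP2⟩
  have hbad' : (((subsetsOfDeg (irreds 𝔽 K) d₁ ×ˢ subsetsOfDeg (irreds 𝔽 K) d₂).filter
      fun T => ¬ Disjoint T.1 T.2).card : ℝ) ≤ 1 / 3 * N ^ (d₁ + d₂) := by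
    calc _ ≤ ∑ P ∈ irreds 𝔽 K, (((subsetsOfDeg (irreds 𝔽 K) d₁).filter (P ∈ ·)).card : ℝ) *
          (((subsetsOfDeg (irreds 𝔽 K) d₂).filter (P ∈ ·)).card : ℝ) := by
          have := (Finset.card_le_card hbad).trans Finset.card_biUnion_le
          simp only [Finset.card_product] at this
          exact_mod_cast this
      _ ≤ ∑ P ∈ irreds 𝔽 K, N ^ (d₁ + d₂) * (N ^ (2 * P.natDegree))⁻¹ := by
          refine Finset.sum_le_sum fun P _ => ?_
          calc _ ≤ N ^ ((d₁ : ℤ) - P.natDegree) * N ^ ((d₂ : ℤ) - P.natDegree) :=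
                mul_le_mul (card_filter_mem_subsetsOfDeg_le (isPrimeSet_irreds K) P d₁)
                  (card_filter_mem_subsetsOfDeg_le (isPrimeSet_irreds K) P d₂)
                  (Nat.cast_nonneg _) (by positivity)
            _ = _ := by
                rw [← zpow_add₀ hq0, ← zpow_natCast, ← zpow_natCast, ← zpow_neg, ← zpow_add₀ hq0]
                congr 1; push_cast; ring
      _ = N ^ (d₁ + d₂) * ∑ P ∈ irreds 𝔽 K, (N ^ (2 * P.natDegree))⁻¹ := by rw [Finset.mul_sum]
      _ ≤ N ^ (d₁ + d₂) * (1 / 3) := by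
          gcongr
          refine (sum_natDegree_comp_le (𝔽 := 𝔽) (I := (Finset.range K).image (· + 1))
            (f := fun d => (N ^ (2 * d))⁻¹) (fun P hP => (isPrimeSet_irreds K P hP).1)
            (fun P hP => by
              have := (isPrimeSet_irreds K).natDegree_pos hP
              rw [mem_irreds] at hP
              exact Finset.mem_image.2 ⟨P.natDegree - 1, Finset.mem_range.2 (by omega), by omega⟩)
            fun d => by positivity).trans ?_
          rw [Finset.sum_image fun a _ b _ h => by simpa using h]
          calc _ ≤ ∑ d ∈ Finset.range K, (1 / 4 : ℝ) * (1 / 4) ^ d := by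
                refine Finset.sum_le_sum fun d _ => ?_
                have h3 : (Fintype.card 𝔽 : ℝ) ^ (d + 1) * (N ^ (2 * (d + 1)))⁻¹ =
                    (N⁻¹) ^ (d + 1) := by
                  rw [← hN, pow_mul', sq, inv_pow, mul_inv, mul_inv_cancel_left₀ (pow_ne_zero _ hq0)]
                rw [h3, ← pow_succ']
                gcongr
            _ ≤ 1 / 3 := by
                rw [← Finset.mul_sum]
                have : ∑ d ∈ Finset.range K, (1 / 4 : ℝ) ^ d ≤ (1 - 1 / 4)⁻¹ := by
                  rw [← tsum_geometric_of_lt_one (by norm_num) (by norm_num)]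
                  exact (summable_geometric_of_lt_one (by norm_num) (by norm_num)).sum_le_tsum _
                    fun _ _ => by positivity
                norm_num at this ⊢
                linarith
      _ = _ := mul_comm _ _
  have hgood : 9 / 16 * N ^ (d₁ + d₂) ≤ ((subsetsOfDeg (irreds 𝔽 K) d₁).card : ℝ) *
      ((subsetsOfDeg (irreds 𝔽 K) d₂).card : ℝ) := by
    have g1 : 3 / 4 * N ^ d₁ ≤ ((subsetsOfDeg (irreds 𝔽 K) d₁).card : ℝ) :=
      le_trans (by gcongr; linarith) (le_card_subsetsOfDeg_irreds h₁)
    have g2 : 3 / 4 * N ^ d₂ ≤ ((subsetsOfDeg (irreds 𝔽 K) d₂).card : ℝ) :=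
      le_trans (by gcongr; linarith) (le_card_subsetsOfDeg_irreds h₂)
    calc _ = (3 / 4 * N ^ d₁) * (3 / 4 * N ^ d₂) := by rw [pow_add]; ring
      _ ≤ _ := mul_le_mul g1 g2 (by positivity) (Nat.cast_nonneg _)
  have hpos : 0 < N ^ (d₁ + d₂) := by positivity
  have : ((primePairs 𝔽 K d₁ d₂).card : ℝ) = (((subsetsOfDeg (irreds 𝔽 K) d₁ ×ˢ
      subsetsOfDeg (irreds 𝔽 K) d₂).filter fun T => Disjoint T.1 T.2).card : ℝ) := rfl
  rw [this]
  linarith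

/-- Recovers the pair from F₁F₂²: the primes of F₂ are those whose square divides it, and the primes
of F₁ are its other prime divisors when the two sets are disjoint. -/
theorem mem_iff_dvd_prod_mul_prod_sq {T : Finset 𝔽[X] × Finset 𝔽[X]} (h₁ : IsPrimeSet T.1)
    (h₂ : IsPrimeSet T.2) {P : 𝔽[X]} (hP : P.Monic) (hPi : Irreducible P) :
    (P ∈ T.2 ↔ P ^ 2 ∣ (∏ P ∈ T.1, P) * (∏ P ∈ T.2, P) ^ 2) ∧
    (P ∈ T.1 ∨ P ∈ T.2 ↔ P ∣ (∏ P ∈ T.1, P) * (∏ P ∈ T.2, P) ^ 2) := by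
  have hor : P ∈ T.1 ∨ P ∈ T.2 ↔ P ∣ (∏ P ∈ T.1, P) * (∏ P ∈ T.2, P) ^ 2 := by
    rw [hPi.prime.dvd_mul, hPi.prime.dvd_pow_iff_dvd two_ne_zero, h₁.dvd_prod_iff hP hPi,
      h₂.dvd_prod_iff hP hPi]
  refine ⟨⟨fun h => ?_, fun h => ?_⟩, hor⟩
  · exact (pow_dvd_pow_of_dvd ((h₂.dvd_prod_iff hP hPi).2 h) 2).trans (dvd_mul_left _ _)
  · by_contra h2
    have hc : IsCoprime (P ^ 2) ((∏ P ∈ T.2, P) ^ 2) := by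
      refine IsCoprime.pow ?_
      rw [hPi.coprime_iff_not_dvd, h₂.dvd_prod_iff hP hPi]
      exact h2
    have h3 := hc.dvd_of_dvd_mul_right h
    rw [sq] at h3
    exact hPi.not_isUnit (h₁.squarefree_prod P h3)

theorem primePairs_injOn (K d₁ d₂ : ℕ) :
    Set.InjOn (fun T : Finset 𝔽[X] × Finset 𝔽[X] => (∏ P ∈ T.1, P) * (∏ P ∈ T.2, P) ^ 2)
      (primePairs 𝔽 K d₁ d₂) := by
  intro T hT U hU h
  rw [Finset.mem_coe, mem_primePairs] at hT hU
  simp only at h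
  obtain ⟨hT1, -, hT2, -, hT3⟩ := hT
  obtain ⟨hU1, -, hU2, -, hU3⟩ := hU
  have hp {S : Finset 𝔽[X]} (hS : S ⊆ irreds 𝔽 K) := (isPrimeSet_irreds K).mono hS
  have key : ∀ P ∈ irreds 𝔽 K, (P ∈ T.2 ↔ P ∈ U.2) ∧ (P ∈ T.1 ↔ P ∈ U.1) := by
    intro P hP
    have hP' := isPrimeSet_irreds K P hP
    have a1 := mem_iff_dvd_prod_mul_prod_sq (hp hT1) (hp hT2) hP'.1 hP'.2
    have a2 := mem_iff_dvd_prod_mul_prod_sq (hp hU1) (hp hU2) hP'.1 hP'.2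
    rw [h, ← a2.1, ← a2.2] at a1
    have b1 : P ∈ T.1 → P ∉ T.2 := fun h => Finset.disjoint_left.1 hT3 h
    have b2 : P ∈ U.1 → P ∉ U.2 := fun h => Finset.disjoint_left.1 hU3 h
    exact ⟨a1.1, fun h' => (a1.2.1 (Or.inl h')).resolve_right fun h'' => b1 h' (a1.1.2 h''),
      fun h' => (a1.2.2 (Or.inl h')).resolve_right fun h'' => b2 h' (a1.1.1 h'')⟩
  refine Prod.ext ?_ ?_
  · ext P
    exact ⟨fun hP => (key P (hT1 hP)).2.1 hP, fun hP => (key P (hU1 hP)).2.2 hP⟩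
  · ext P
    exact ⟨fun hP => (key P (hT2 hP)).1.1 hP, fun hP => (key P (hU2 hP)).1.2 hP⟩

theorem image_primePairs {K d₁ d₂ : ℕ} (h₁ : d₁ ≤ K) (h₂ : d₂ ≤ K) :
    (fun T : Finset 𝔽[X] × Finset 𝔽[X] => (∏ P ∈ T.1, P) * (∏ P ∈ T.2, P) ^ 2) ''
      (primePairs 𝔽 K d₁ d₂) = cubeFreeFamily 𝔽 d₁ d₂ := by
  have hp {S : Finset 𝔽[X]} (hS : S ⊆ irreds 𝔽 K) := (isPrimeSet_irreds K).mono hS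
  ext F
  constructor
  · rintro ⟨T, hT, rfl⟩
    rw [Finset.mem_coe, mem_primePairs] at hT
    obtain ⟨hT1, hd1, hT2, hd2, hT3⟩ := hT
    refine ⟨∏ P ∈ T.1, P, ∏ P ∈ T.2, P, (hp hT1).monic_prod, (hp hT2).monic_prod,
      (hp hT1).squarefree_prod, (hp hT2).squarefree_prod, ?_, ?_, ?_, rfl⟩
    · refine IsCoprime.prod_left fun P hP => IsCoprime.prod_right fun Q hQ => ?_
      have hP' := hp hT1 P hP
      have hQ' := hp hT2 Q hQ
      refine isCoprime_of_monic_irreducible_ne hP'.1 hQ'.1 hP'.2 hQ'.2 ?_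
      rintro rfl
      exact Finset.disjoint_left.1 hT3 hP hQ
    · rw [(hp hT1).natDegree_prod, hd1]
    · rw [(hp hT2).natDegree_prod, hd2]
  · rintro ⟨F₁, F₂, hm1, hm2, hs1, hs2, hc, hd1, hd2, rfl⟩
    obtain ⟨hT1, he1⟩ := exists_irreds_prod_eq (K := K) hm1 hs1 (by omega)
    obtain ⟨hT2, he2⟩ := exists_irreds_prod_eq (K := K) hm2 hs2 (by omega)
    refine ⟨((irreds 𝔽 K).filter (· ∣ F₁), (irreds 𝔽 K).filter (· ∣ F₂)), ?_, by
      simp only [he1, he2]⟩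
    rw [Finset.mem_coe, mem_primePairs]
    refine ⟨hT1, ?_, hT2, ?_, ?_⟩
    · rw [← (hp hT1).natDegree_prod, he1, hd1]
    · rw [← (hp hT2).natDegree_prod, he2, hd2]
    · rw [Finset.disjoint_left]
      intro P hP1 hP2
      rw [Finset.mem_filter, mem_irreds] at hP1 hP2
      exact hP1.1.2.2.not_isUnit (hc.isUnit_of_dvd' hP1.2 hP2.2)

theorem ncard_cubeFreeFamily {K d₁ d₂ : ℕ} (h₁ : d₁ ≤ K) (h₂ : d₂ ≤ K) :
    (cubeFreeFamily 𝔽 d₁ d₂).ncard = (primePairs 𝔽 K d₁ d₂).card := by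
  rw [← image_primePairs h₁ h₂, (primePairs_injOn K d₁ d₂).ncard_image,
    Set.ncard_coe_finset]

theorem ncard_filter_cubeFreeFamily {K d₁ d₂ : ℕ} (h₁ : d₁ ≤ K) (h₂ : d₂ ≤ K) (χ : MulChar 𝔽 ℂ)
    (s : ℂ) :
    {F ∈ cubeFreeFamily 𝔽 d₁ d₂ | affineCharSum χ F = s}.ncard =
      ((primePairs 𝔽 K d₁ d₂).filter fun T => ∑ x, pairValue χ T x = s).card := by
  rw [← Set.ncard_coe_finset, ← ((primePairs_injOn K d₁ d₂).mono
    (Finset.coe_subset.2 (Finset.filter_subset _ _))).ncard_image]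
  congr 1
  ext F
  simp only [← image_primePairs h₁ h₂]
  constructor
  · rintro ⟨⟨T, hT, rfl⟩, hs⟩
    exact ⟨T, Finset.mem_coe.2 (Finset.mem_filter.2 ⟨hT, hs⟩), rfl⟩
  · rintro ⟨T, hT, rfl⟩
    rw [Finset.mem_coe, Finset.mem_filter] at hT
    exact ⟨⟨T, hT.1, rfl⟩, hT.2⟩

end FamilyCounts

/-! ### Comparison with the random model. -/

section Summation

open scoped Classical

/-- The mass function of the summands of the random model. -/
noncomputable def modelMass (q : ℝ) (z : ℂ) : ℝ := if z = 0 then 2 / (q + 2) else q / (3 * (q + 2))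

/-- The possible values of a cubic character. -/
noncomputable def cubicValues (ω : ℂ) : Finset ℂ := {0, 1, ω, ω ^ 2}

theorem mem_cubicValues_iff {ω : ℂ} (hω : IsPrimitiveRoot ω 3) {z : ℂ} :
    z ∈ cubicValues ω ↔ z = 0 ∨ z ^ 3 = 1 := by
  simp only [cubicValues, Finset.mem_insert, Finset.mem_singleton]
  refine or_congr_right ?_
  constructor
  · rintro (rfl | rfl | rfl)
    · simp
    · exact hω.pow_eq_one
    · rw [← pow_mul, mul_comm, pow_mul, hω.pow_eq_one, one_pow]
  · intro h
    obtain ⟨i, hi, rfl⟩ := hω.eq_pow_of_pow_eq_one h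
    interval_cases i <;> simp

theorem sum_cubicValues {ω : ℂ} (hω : IsPrimitiveRoot ω 3) (f : ℂ → ℝ) :
    ∑ z ∈ cubicValues ω, f z = f 0 + f 1 + f ω + f (ω ^ 2) := by
  have h0 : ω ≠ 0 := hω.ne_zero (by norm_num)
  have h1 : ω ≠ 1 := hω.ne_one (by norm_num)
  have h2 : ω ^ 2 ≠ 1 := hω.pow_ne_one_of_pos_of_lt (by norm_num) (by norm_num)
  have h3 : ω ≠ ω ^ 2 := fun h => h1 (mul_left_cancel₀ h0 (by rw [mul_one, ← sq, ← h]))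
  rw [cubicValues, Finset.sum_insert, Finset.sum_insert, Finset.sum_insert, Finset.sum_singleton]
  · ring
  · simpa using h3
  · simp only [Finset.mem_insert, Finset.mem_singleton, not_or]
    exact ⟨h1.symm, h2.symm⟩
  · simp only [Finset.mem_insert, Finset.mem_singleton, not_or]
    exact ⟨zero_ne_one, h0.symm, (pow_ne_zero 2 h0).symm⟩

theorem sum_modelMass {ω : ℂ} (hω : IsPrimitiveRoot ω 3) {q : ℝ} (hq : 0 < q) :
    ∑ z ∈ cubicValues ω, modelMass q z = 1 := by
  have h0 : ω ≠ 0 := hω.ne_zero (by norm_num)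
  simp only [sum_cubicValues hω, modelMass, if_true, one_ne_zero, if_false, h0,
    pow_ne_zero 2 h0]
  field_simp
  ring

theorem modelMass_nonneg {q : ℝ} (hq : 0 < q) (z : ℂ) : 0 ≤ modelMass q z := by
  rw [modelMass]; split_ifs <;> positivity

variable {𝔽 : Type*} [Field 𝔽] [Fintype 𝔽]

/-- Where the law of the Xᵢ comes from. A point with a(x) = 0 has weight 2(q-1)/q, the 2 counting
whether the root lies in F₁ or in F₂; any other point has weight (q-1)/3. Normalising so that the
four values have total 1 leaves the factor (q-1)(q+2)/q per point. -/
theorem residueCount_mul_zpow (a : 𝔽 → ℂ) :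
    (2 : ℝ) ^ (Finset.univ.filter (a · = 0)).card * (residueCount a *
      (Fintype.card 𝔽 : ℝ) ^ (-((Finset.univ.filter (a · = 0)).card : ℤ))) =
    (((Fintype.card 𝔽 : ℝ) - 1) * ((Fintype.card 𝔽 : ℝ) + 2) / Fintype.card 𝔽) ^ Fintype.card 𝔽 *
      ∏ x, modelMass (Fintype.card 𝔽) (a x) := by
  have hq0 : (0 : ℝ) < Fintype.card 𝔽 := by exact_mod_cast Fintype.card_pos
  set N : ℝ := (Fintype.card 𝔽 : ℝ)
  have h1 : ∀ c : ℝ, c ^ (Finset.univ.filter (a · = 0)).card = ∏ x, if a x = 0 then c else 1 := by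
    intro c
    rw [Finset.prod_ite, Finset.prod_const, Finset.prod_const_one, mul_one]
  rw [zpow_neg, zpow_natCast, ← inv_pow, h1, h1, residueCount, ← Finset.card_univ,
    ← Finset.prod_const, ← Finset.prod_mul_distrib, ← Finset.prod_mul_distrib,
    ← Finset.prod_mul_distrib]
  refine Finset.prod_congr rfl fun x _ => ?_
  rw [modelMass]
  split_ifs
  · field_simp
    rw [Finset.card_univ]
  · field_simp
    rw [Finset.card_univ]

theorem card_filter_pairValue {K d₁ d₂ : ℕ} (χ : MulChar 𝔽 ℂ) (a : 𝔽 → ℂ) :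
    ((primePairs 𝔽 K d₁ d₂).filter fun T => pairValue χ T = a).card =
      ∑ A ∈ (Finset.univ.filter (a · = 0)).powerset, (pairsWithValues K d₁ d₂ χ a A).card := by
  have hmaps : ∀ T ∈ (primePairs 𝔽 K d₁ d₂).filter fun T => pairValue χ T = a,
      linearRoots T.1 ∈ (Finset.univ.filter (a · = 0)).powerset := by
    intro T hT
    rw [Finset.mem_filter, mem_primePairs] at hT
    rw [Finset.mem_powerset]
    intro x hx
    rw [Finset.mem_filter, ← hT.2, pairValue_eq_zero_iff ((isPrimeSet_irreds K).mono hT.1.1)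
      ((isPrimeSet_irreds K).mono hT.1.2.2.1)]
    exact ⟨Finset.mem_univ _, Or.inl hx⟩
  rw [Finset.card_eq_sum_card_fiberwise hmaps]
  refine Finset.sum_congr rfl fun A _ => ?_
  rw [pairsWithValues, Finset.filter_filter]

theorem pairValue_mem {χ : MulChar 𝔽 ℂ} (hχ : orderOf χ = 3) {ω : ℂ} (hω : IsPrimitiveRoot ω 3)
    (T : Finset 𝔽[X] × Finset 𝔽[X]) : pairValue χ T ∈ Fintype.piFinset fun _ => cubicValues ω := by
  rw [Fintype.mem_piFinset]
  intro x
  rw [mem_cubicValues_iff hω, pairValue]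
  by_cases h : ((∏ P ∈ T.1, P) * (∏ P ∈ T.2, P) ^ 2).eval x = 0
  · left; rw [h, MulChar.map_zero]
  · right; exact mulChar_pow_three_eq_one hχ h

/-- The probability that the random model takes the value `s`. -/
noncomputable def modelProb (ι : Type*) [Fintype ι] [DecidableEq ι] (q : ℝ) (ω s : ℂ) : ℝ :=
  ∑ a ∈ (Fintype.piFinset fun _ : ι => cubicValues ω).filter fun a => ∑ x, a x = s,
    ∏ x, modelMass q (a x)

theorem abs_card_filter_pairValue_sub_le {K d₁ d₂ : ℕ} (hK : 1 ≤ K) (h₁ : d₁ ≤ K) (h₂ : d₂ ≤ K)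
    (h4 : 4 ≤ Fintype.card 𝔽)
    {χ : MulChar 𝔽 ℂ} (hχ : orderOf χ = 3) {a : 𝔽 → ℂ} (ha : ∀ x, a x = 0 ∨ a x ^ 3 = 1)
    {t r : ℝ} (ht : 2 ≤ t)
    (htq : t ^ 2 = Fintype.card 𝔽) (hqr : (Fintype.card 𝔽 : ℝ)⁻¹ ≤ r) (hr : r < 1) {W η : ℝ}
    (hW : W = sqfreeDensity 𝔽 K * meanDensity 𝔽 K *
      (Fintype.card 𝔽 : ℝ) ^ ((d₁ : ℤ) + d₂ - Fintype.card 𝔽) *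
      (((Fintype.card 𝔽 : ℝ) - 1) * ((Fintype.card 𝔽 : ℝ) + 2) / Fintype.card 𝔽) ^ Fintype.card 𝔽)
    (hη : η = 128 * t ^ (3 * (Fintype.card 𝔽 : ℤ) - d₁) +
      8 * (((1 - r)⁻¹) ^ Fintype.card 𝔽 * Real.exp (((1 - r)⁻¹) ^ 2)) *
        (r * Fintype.card 𝔽) ^ ((Fintype.card 𝔽 : ℤ) - d₂)) :
    |(((primePairs 𝔽 K d₁ d₂).filter fun T => pairValue χ T = a).card : ℝ) -
        W * ∏ x, modelMass (Fintype.card 𝔽) (a x)| ≤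
      W * (∏ x, modelMass (Fintype.card 𝔽) (a x)) * η := by
  have hmain : W * ∏ x, modelMass (Fintype.card 𝔽) (a x) =
      ∑ A ∈ (Finset.univ.filter (a · = 0)).powerset, (sqfreeDensity 𝔽 K * meanDensity 𝔽 K *
      (Fintype.card 𝔽 : ℝ) ^ ((d₁ : ℤ) + d₂ - Fintype.card 𝔽)) * (residueCount a *
        (Fintype.card 𝔽 : ℝ) ^ (-((Finset.univ.filter (a · = 0)).card : ℤ))) := by
    rw [Finset.sum_const, Finset.card_powerset, nsmul_eq_mul, Nat.cast_pow, Nat.cast_ofNat, hW,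
      mul_left_comm, residueCount_mul_zpow]
    ring
  rw [hmain, card_filter_pairValue, Nat.cast_sum, ← Finset.sum_sub_distrib, Finset.sum_mul]
  refine (Finset.abs_sum_le_sum_abs _ _).trans (Finset.sum_le_sum fun A hA => ?_)
  exact abs_card_pairsWithValues_sub_le' hK h₁ h₂ h4 hχ ha (Finset.mem_powerset.1 hA) ht htq hqr hr
    rfl hη

/-- Both the number of pairs with a given character sum and the number of all pairs are
asymptotically given by the random model. -/
theorem abs_card_filter_sum_pairValue_sub_le {K d₁ d₂ : ℕ} (hK : 1 ≤ K) (h₁ : d₁ ≤ K) (h₂ : d₂ ≤ K)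
    (h4 : 4 ≤ Fintype.card 𝔽) {ω : ℂ} (hω : IsPrimitiveRoot ω 3)
    {χ : MulChar 𝔽 ℂ} (hχ : orderOf χ = 3)
    {t r : ℝ} (ht : 2 ≤ t)
    (htq : t ^ 2 = Fintype.card 𝔽) (hqr : (Fintype.card 𝔽 : ℝ)⁻¹ ≤ r) (hr : r < 1) {W η : ℝ}
    (hW : W = sqfreeDensity 𝔽 K * meanDensity 𝔽 K *
      (Fintype.card 𝔽 : ℝ) ^ ((d₁ : ℤ) + d₂ - Fintype.card 𝔽) *
      (((Fintype.card 𝔽 : ℝ) - 1) * ((Fintype.card 𝔽 : ℝ) + 2) / Fintype.card 𝔽) ^ Fintype.card 𝔽)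
    (hη : η = 128 * t ^ (3 * (Fintype.card 𝔽 : ℤ) - d₁) +
      8 * (((1 - r)⁻¹) ^ Fintype.card 𝔽 * Real.exp (((1 - r)⁻¹) ^ 2)) *
        (r * Fintype.card 𝔽) ^ ((Fintype.card 𝔽 : ℤ) - d₂)) (p : ℂ → Prop) :
    |(((primePairs 𝔽 K d₁ d₂).filter fun T => p (∑ x, pairValue χ T x)).card : ℝ) -
        W * ∑ a ∈ (Fintype.piFinset fun _ : 𝔽 => cubicValues ω).filter fun a => p (∑ x, a x),
          ∏ x, modelMass (Fintype.card 𝔽) (a x)| ≤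
      W * (∑ a ∈ (Fintype.piFinset fun _ : 𝔽 => cubicValues ω).filter fun a => p (∑ x, a x),
          ∏ x, modelMass (Fintype.card 𝔽) (a x)) * η := by
  have hmaps : ∀ T ∈ (primePairs 𝔽 K d₁ d₂).filter fun T => p (∑ x, pairValue χ T x),
      pairValue χ T ∈
        (Fintype.piFinset fun _ : 𝔽 => cubicValues ω).filter fun a => p (∑ x, a x) := by
    intro T hT
    rw [Finset.mem_filter] at hT ⊢
    exact ⟨pairValue_mem hχ hω T, hT.2⟩
  rw [Finset.card_eq_sum_card_fiberwise hmaps, Nat.cast_sum, Finset.mul_sum,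
    ← Finset.sum_sub_distrib, Finset.sum_mul]
  refine (Finset.abs_sum_le_sum_abs _ _).trans (Finset.sum_le_sum fun a ha => ?_)
  rw [Finset.mem_filter, Fintype.mem_piFinset] at ha
  have hfil : ((primePairs 𝔽 K d₁ d₂).filter fun T => p (∑ x, pairValue χ T x)).filter
      (fun T => pairValue χ T = a) = (primePairs 𝔽 K d₁ d₂).filter fun T => pairValue χ T = a := by
    rw [Finset.filter_filter]
    refine Finset.filter_congr fun T _ => ⟨fun h => h.2, fun h => ⟨?_, h⟩⟩
    rw [h]; exact ha.2
  rw [hfil]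
  exact abs_card_filter_pairValue_sub_le hK h₁ h₂ h4 hχ
    (fun x => (mem_cubicValues_iff hω).1 (ha.1 x)) ht htq hqr hr hW hη

theorem sum_prod_modelMass (ι : Type*) [Fintype ι] [DecidableEq ι] {ω : ℂ} (hω : IsPrimitiveRoot ω 3) {q : ℝ}
    (hq : 0 < q) :
    ∑ a ∈ Fintype.piFinset fun _ : ι => cubicValues ω, ∏ x, modelMass q (a x) = 1 := by
  rw [← Finset.prod_univ_sum]
  simp [sum_modelMass hω hq]

theorem modelProb_congr {ι κ : Type*} [Fintype ι] [DecidableEq ι] [Fintype κ] [DecidableEq κ] (e : ι ≃ κ) (q : ℝ) (ω s : ℂ) :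
    modelProb ι q ω s = modelProb κ q ω s := by
  refine Finset.sum_bij (fun a _ => a ∘ e.symm) ?_ ?_ ?_ ?_
  · intro a ha
    rw [Finset.mem_filter, Fintype.mem_piFinset] at ha ⊢
    refine ⟨fun x => ha.1 _, ?_⟩
    rw [← ha.2]
    exact Equiv.sum_comp e.symm a
  · intro a _ b _ h
    funext x
    simpa using congrFun h (e x)
  · intro b hb
    rw [Finset.mem_filter, Fintype.mem_piFinset] at hb
    refine ⟨b ∘ e, ?_, by funext x; simp⟩
    rw [Finset.mem_filter, Fintype.mem_piFinset]
    refine ⟨fun x => hb.1 _, ?_⟩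
    rw [← hb.2]
    exact Equiv.sum_comp e b
  · intro a _
    exact (Equiv.prod_comp e.symm fun x => modelMass q (a x)).symm

/-- The four prescribed masses add up to 1, so almost surely every Xᵢ takes one of the four values.
The event is then, up to a null set, a disjoint union over value vectors, each of product
probability by independence. -/
theorem measureReal_sum_eq {q : ℕ} (hq : 0 < q) {ω : ℂ} (hω : IsPrimitiveRoot ω 3)
    {Ω : Type*} [MeasurableSpace Ω] {P : Measure Ω} [IsProbabilityMeasure P]
    {X : Fin q → Ω → ℂ} (hX : ∀ i, Measurable (X i)) (hind : iIndepFun X P)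
    (h0 : ∀ i, P.real {w | X i w = 0} = 2 / ((q : ℝ) + 2))
    (h1 : ∀ i, ∀ z ∈ ({1, ω, ω ^ 2} : Set ℂ),
      P.real {w | X i w = z} = (q : ℝ) / (3 * ((q : ℝ) + 2))) (s : ℂ) :
    P.real {w | ∑ i, X i w = s} = modelProb (Fin q) q ω s := by
  have hq0 : (0 : ℝ) < q := by exact_mod_cast hq
  have hmass : ∀ i, ∀ z ∈ cubicValues ω, P.real (X i ⁻¹' {z}) = modelMass q z := by
    intro i z hz
    have he : X i ⁻¹' {z} = {w | X i w = z} := rfl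
    rw [he, modelMass]
    split_ifs with h
    · subst h; exact h0 i
    · refine h1 i z ?_
      simp only [cubicValues, Finset.mem_insert, Finset.mem_singleton, h, false_or] at hz
      simpa using hz
  have hprod : ∀ a ∈ Fintype.piFinset fun _ : Fin q => cubicValues ω,
      P.real {w | ∀ i, X i w = a i} = ∏ i, modelMass q (a i) := by
    intro a ha
    rw [Fintype.mem_piFinset] at ha
    have := hind.measure_inter_preimage_eq_mul Finset.univ (sets := fun i => {a i})
      fun i _ => MeasurableSet.singleton _
    have he : {w | ∀ i, X i w = a i} = ⋂ i ∈ Finset.univ, X i ⁻¹' {a i} := by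
      ext w; simp
    rw [he, measureReal_def, this, ENNReal.toReal_prod]
    exact Finset.prod_congr rfl fun i _ => hmass i _ (ha i)
  have hmeas : ∀ a : Fin q → ℂ, MeasurableSet {w | ∀ i, X i w = a i} := by
    intro a
    have he : {w | ∀ i, X i w = a i} = ⋂ i, X i ⁻¹' {a i} := by ext w; simp
    rw [he]
    exact MeasurableSet.iInter fun i => hX i (MeasurableSet.singleton _)
  have hunion : ∀ S : Finset (Fin q → ℂ), S ⊆ Fintype.piFinset (fun _ => cubicValues ω) →
      P.real (⋃ a ∈ S, {w | ∀ i, X i w = a i}) = ∑ a ∈ S, ∏ i, modelMass q (a i) := by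
    intro S hS
    rw [measureReal_biUnion_finset]
    · exact Finset.sum_congr rfl fun a ha => hprod a (hS ha)
    · intro a _ b _ hab
      rw [Function.onFun, Set.disjoint_left]
      intro w hw hw'
      exact hab (funext fun i => (hw i).symm.trans (hw' i))
    · exact fun a _ => hmeas a
  have hfull := hunion _ (Finset.Subset.refl _)
  rw [sum_prod_modelMass (Fin q) hω hq0] at hfull
  have hae : ∀ᵐ w ∂P, w ∈ ⋃ a ∈ Fintype.piFinset (fun _ : Fin q => cubicValues ω),
      {w | ∀ i, X i w = a i} := by
    have hU : MeasurableSet (⋃ a ∈ Fintype.piFinset (fun _ : Fin q => cubicValues ω),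
        {w | ∀ i, X i w = a i}) := Finset.measurableSet_biUnion _ fun a _ => hmeas a
    rw [measureReal_def, ENNReal.toReal_eq_one_iff] at hfull
    exact mem_ae_iff.2 ((prob_compl_eq_zero_iff hU).2 hfull)
  rw [modelProb, ← hunion _ (Finset.filter_subset _ _)]
  refine measureReal_congr (Filter.eventuallyEq_set.2 ?_)
  filter_upwards [hae] with w hw
  simp only [Set.mem_iUnion, Set.mem_ofPred_eq, exists_prop, Finset.mem_filter] at hw ⊢
  obtain ⟨a, ha, hwa⟩ := hw
  constructor
  · intro h
    refine ⟨a, ⟨ha, ?_⟩, hwa⟩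
    rw [← h]
    exact Finset.sum_congr rfl fun i _ => (hwa i).symm
  · rintro ⟨b, ⟨-, hb⟩, hwb⟩
    rw [← hb]
    exact Finset.sum_congr rfl fun i _ => hwb i

end Summation

/-! ### Uniform bounds for the error terms and the final quotient. -/

section ErrorTerms

open scoped Classical

/-- With r = q^(-ε), the power (rq)^(q-d) is r^q times the power of q on the right, so the loss
(1-r)^(-q) becomes (r/(1-r))^q. This is at most 1 once r ≤ 1/2; otherwise q < 2^(1/ε), and the
finitely many such q only affect the constant. -/
theorem exists_inv_one_sub_pow_mul_exp_le {ε : ℝ} (hε : 0 < ε) :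
    ∃ C : ℝ, 0 ≤ C ∧ ∀ q : ℕ, 4 ≤ q → ∀ d : ℕ,
      ((1 - (q : ℝ) ^ (-ε))⁻¹) ^ q * Real.exp (((1 - (q : ℝ) ^ (-ε))⁻¹) ^ 2) *
        ((q : ℝ) ^ (-ε) * q) ^ ((q : ℤ) - d) ≤ C * (q : ℝ) ^ (-(1 - ε) * (d : ℝ) + (q : ℝ)) := by
  set ρ : ℝ := (4 : ℝ) ^ (-ε) with hρ
  have hρ1 : ρ < 1 := Real.rpow_lt_one_of_one_lt_of_neg (by norm_num) (by linarith)
  have hρ0 : 0 < ρ := by positivity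
  set G : ℝ := max 1 (ρ / (1 - ρ)) with hG
  have hG1 : 1 ≤ G := le_max_left _ _
  refine ⟨G ^ ⌈(2 : ℝ) ^ ε⁻¹⌉₊ * Real.exp (((1 - ρ)⁻¹) ^ 2), by positivity, fun q hq d => ?_⟩
  have hq4 : (4 : ℝ) ≤ q := by exact_mod_cast hq
  have hq0 : (0 : ℝ) < q := by linarith
  set r : ℝ := (q : ℝ) ^ (-ε) with hr
  have hr0 : 0 < r := by positivity
  have hrρ : r ≤ ρ := Real.rpow_le_rpow_of_nonpos (by norm_num) hq4 (by linarith)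
  have h1ρ : 0 < 1 - ρ := by linarith
  have h1r : 0 < 1 - r := by linarith
  have hsplit : (r * q) ^ ((q : ℤ) - d) = r ^ q * (q : ℝ) ^ (-(1 - ε) * (d : ℝ) + (q : ℝ)) := by
    have h1 : r * q = (q : ℝ) ^ (1 - ε) := by
      rw [hr, sub_eq_neg_add, Real.rpow_add hq0, Real.rpow_one]
    rw [h1, ← Real.rpow_intCast, ← Real.rpow_mul hq0.le, hr, ← Real.rpow_natCast _ q,
      ← Real.rpow_mul hq0.le, ← Real.rpow_add hq0]
    congr 1
    push_cast
    ring
  have hpow : (r / (1 - r)) ^ q ≤ G ^ ⌈(2 : ℝ) ^ ε⁻¹⌉₊ := by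
    rcases le_or_gt r (1 / 2) with h | h
    · refine le_trans (pow_le_one₀ (by positivity) ?_) (one_le_pow₀ hG1)
      rw [div_le_one h1r]
      linarith
    · have hqL : (q : ℝ) ≤ (2 : ℝ) ^ ε⁻¹ := by
        have h2 : (q : ℝ) ^ ε < 2 := by
          rw [hr, Real.rpow_neg hq0.le, one_div] at h
          exact (inv_lt_inv₀ (by norm_num) (by positivity)).1 h
        calc (q : ℝ) = ((q : ℝ) ^ ε) ^ ε⁻¹ := by
              rw [← Real.rpow_mul hq0.le, mul_inv_cancel₀ hε.ne', Real.rpow_one]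
          _ ≤ _ := by gcongr
      calc (r / (1 - r)) ^ q ≤ G ^ q := by
            gcongr
            refine le_trans ?_ (le_max_right _ _)
            gcongr
        _ ≤ _ := pow_le_pow_right₀ hG1 (by exact_mod_cast hqL.trans (Nat.le_ceil _))
  rw [hsplit]
  calc _ = (r / (1 - r)) ^ q * Real.exp (((1 - r)⁻¹) ^ 2) *
        (q : ℝ) ^ (-(1 - ε) * (d : ℝ) + (q : ℝ)) := by
        rw [div_eq_mul_inv, mul_pow]; ring
    _ ≤ _ := by gcongr

theorem sqrt_zpow_eq_rpow (q d : ℕ) :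
    (√(q : ℝ)) ^ (3 * (q : ℤ) - d) = (q : ℝ) ^ (-((d : ℝ) - 3 * (q : ℝ)) / 2) := by
  rw [Real.sqrt_eq_rpow, ← Real.rpow_intCast, ← Real.rpow_mul (Nat.cast_nonneg q)]
  congr 1
  push_cast
  ring

/-- (N-1)(N+2)/N² = 1 + 1/N - 2/N² ≤ e^(1/N), so its N-th power is at most e. It bounds the common
factor W by the trivial size of the family. -/
theorem mul_pow_le_three {N : ℕ} (hN : 4 ≤ N) (D : ℕ) {κ c : ℝ} (hκ : κ ≤ 1)
    (hc0 : 0 ≤ c) (hc : c ≤ 1) :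
    κ * c * (N : ℝ) ^ ((D : ℤ) - N) * (((N : ℝ) - 1) * ((N : ℝ) + 2) / N) ^ N ≤
      3 * (N : ℝ) ^ D := by
  have hN4 : (4 : ℝ) ≤ N := by exact_mod_cast hN
  have hN0 : (N : ℝ) ≠ 0 := by positivity
  have h1 : (((N : ℝ) - 1) * ((N : ℝ) + 2) / N) ^ N * ((N : ℝ) ^ N)⁻¹ ≤ 3 := by
    rw [← inv_pow, ← mul_pow]
    have h0 : 0 ≤ (N : ℝ) - 1 := by linarith
    calc _ ≤ (Real.exp ((N : ℝ)⁻¹)) ^ N := by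
          gcongr
          refine le_trans ?_ (Real.add_one_le_exp _)
          have : ((N : ℝ) - 1) * ((N : ℝ) + 2) / N * (N : ℝ)⁻¹ =
              (N : ℝ)⁻¹ + 1 - 2 * ((N : ℝ)⁻¹) ^ 2 := by field_simp; ring
          rw [this]
          have : 0 ≤ 2 * ((N : ℝ)⁻¹) ^ 2 := by positivity
          linarith
      _ = Real.exp 1 := by rw [← Real.exp_nat_mul, mul_inv_cancel₀ hN0]
      _ ≤ 3 := by linarith [Real.exp_one_lt_d9]
  have h2 : κ * c ≤ 1 := mul_le_one₀ hκ hc0 hc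
  rw [zpow_sub₀ hN0, zpow_natCast, zpow_natCast, div_eq_mul_inv]
  have h3 : 0 ≤ (((N : ℝ) - 1) * ((N : ℝ) + 2) / N) ^ N * ((N : ℝ) ^ N)⁻¹ := by
    have h0 : 0 ≤ (N : ℝ) - 1 := by linarith
    positivity
  calc _ = κ * c * ((((N : ℝ) - 1) * ((N : ℝ) + 2) / N) ^ N * ((N : ℝ) ^ N)⁻¹) * (N : ℝ) ^ D := by
        ring
    _ ≤ 1 * 3 * (N : ℝ) ^ D := by gcongr
    _ = _ := by ring

/-- If `n ≈ W p` and `T ≈ W` with relative error `η`, then `n / T = p (1 + δ)` with `δ = O(η)`. -/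
theorem exists_div_eq_mul_one_add {n T W p η Q : ℝ} (hQ : 0 < Q) (hT : 1 / 5 * Q ≤ T)
    (hW : W ≤ 3 * Q) (hη : 0 ≤ η) (hp : 0 ≤ p) (h₁ : |n - W * p| ≤ W * p * η)
    (h₂ : |T - W * 1| ≤ W * 1 * η) :
    ∃ δ : ℝ, |δ| ≤ 30 * η ∧ n / T = p * (1 + δ) := by
  have hT0 : 0 < T := by linarith
  rcases hp.eq_or_lt with rfl | hp0
  -- An unattainable s: the relative error bound forces the count to be exactly 0.
  · refine ⟨0, by rw [abs_zero]; positivity, ?_⟩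
    have : n = 0 := by simpa using h₁
    rw [this]; simp
  · refine ⟨(n - T * p) / (T * p), ?_, ?_⟩
    · rw [abs_div, abs_of_pos (mul_pos hT0 hp0), div_le_iff₀ (mul_pos hT0 hp0)]
      have h3 : |n - T * p| ≤ W * p * η + W * η * p := by
        calc |n - T * p| = |(n - W * p) - (T - W * 1) * p| := by ring_nf
          _ ≤ |n - W * p| + |(T - W * 1) * p| := abs_sub _ _
          _ ≤ _ := by
              rw [abs_mul, abs_of_pos hp0]
              refine add_le_add h₁ (mul_le_mul_of_nonneg_right ?_ hp)
              simpa using h₂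
      -- The numerator and the denominator each contribute an error Wpη, hence 30 = 2 · 15. No
      -- smallness of η is used.
      have h4 : W ≤ 15 * T := by linarith
      have h5 := mul_le_mul_of_nonneg_right h4 (mul_nonneg hη hp)
      nlinarith
    · field_simp
      ring

end ErrorTerms

theorem corollary3p2 (ε : ℝ) (hε : 0 < ε) :
    ∃ C : ℝ, ∀ (𝔽 : Type*) [Field 𝔽] [Fintype 𝔽] (q : ℕ), Fintype.card 𝔽 = q → q ≡ 1 [MOD 3] →
      ∀ χ : MulChar 𝔽 ℂ, orderOf χ = 3 →
      ∀ ω : ℂ, IsPrimitiveRoot ω 3 →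
      ∀ (Ω : Type*) [MeasurableSpace Ω] (P : Measure Ω) [IsProbabilityMeasure P]
        (X : Fin q → Ω → ℂ), (∀ i, Measurable (X i)) → iIndepFun X P →
        (∀ i, P.real {w | X i w = 0} = 2 / ((q : ℝ) + 2)) →
        (∀ i, ∀ z ∈ ({1, ω, ω ^ 2} : Set ℂ),
          P.real {w | X i w = z} = (q : ℝ) / (3 * ((q : ℝ) + 2))) →
      ∀ (d₁ d₂ : ℕ) (s : ℂ), s ∈ Algebra.adjoin ℤ {ω} →
        ∃ δ : ℝ,
          |δ| ≤ C * ((q : ℝ) ^ (-(1 - ε) * (d₂ : ℝ) + (q : ℝ)) +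
            (q : ℝ) ^ (-((d₁ : ℝ) - 3 * (q : ℝ)) / 2)) ∧
          (({F ∈ cubeFreeFamily 𝔽 d₁ d₂ | affineCharSum χ F = s}.ncard : ℝ) /
              ((cubeFreeFamily 𝔽 d₁ d₂).ncard : ℝ)) =
            P.real {w | ∑ i, X i w = s} * (1 + δ) := by
  classical
  -- Capping ε guarantees q⁻¹ ≤ r for r = q^(-ε'); a smaller exponent only gives a stronger bound.
  set ε' : ℝ := min ε (1 / 2) with hε'
  have hε'0 : 0 < ε' := lt_min hε (by norm_num)
  have hε'ε : ε' ≤ ε := min_le_left _ _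
  have hε'2 : ε' ≤ 1 / 2 := min_le_right _ _
  obtain ⟨C₀, hC₀, hB⟩ := exists_inv_one_sub_pow_mul_exp_le hε'0
  refine ⟨30 * (128 + 8 * C₀), ?_⟩
  intro 𝔽 _ _ q hcard hmod χ hχ ω hω Ω _ P _ X hX hind h0 h1 d₁ d₂ s _
  -- From q > 1 and q ≡ 1 mod 3. All numerical constants, and √q ≥ 2, rest on this.
  have hq4 : 4 ≤ q := by
    have : 1 < q := hcard ▸ Fintype.one_lt_card
    unfold Nat.ModEq at hmod
    omega
  have h4 : 4 ≤ Fintype.card 𝔽 := hcard.symm ▸ hq4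
  have hq4' : (4 : ℝ) ≤ q := by exact_mod_cast hq4
  have hq0 : (0 : ℝ) < q := by linarith
  have hcardR : (Fintype.card 𝔽 : ℝ) = q := by rw [hcard]
  -- Any bound that is at least d₁, d₂ and 1 would do; the 1 ensures that the linear primes are
  -- included even when d₁ = d₂ = 0.
  set K := d₁ + d₂ + 1 with hK
  have hK1 : 1 ≤ K := by omega
  have hd₁ : d₁ ≤ K := by omega
  have hd₂ : d₂ ≤ K := by omega
  set t : ℝ := √(q : ℝ) with ht
  have ht2 : 2 ≤ t := Real.le_sqrt_of_sq_le (by norm_num; exact hq4)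
  have htq : t ^ 2 = (Fintype.card 𝔽 : ℝ) := by rw [hcardR, ht, Real.sq_sqrt hq0.le]
  set r : ℝ := (q : ℝ) ^ (-ε') with hr
  have hr1 : r < 1 := Real.rpow_lt_one_of_one_lt_of_neg (by linarith) (by linarith)
  have hqr : (Fintype.card 𝔽 : ℝ)⁻¹ ≤ r := by
    rw [hcardR, ← Real.rpow_neg_one]
    exact Real.rpow_le_rpow_of_exponent_le (by linarith) (by linarith)
  have key := abs_card_filter_sum_pairValue_sub_le (d₁ := d₁) (d₂ := d₂) hK1 hd₁ hd₂ h4 hω hχ ht2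
    htq hqr hr1 rfl rfl
  have hs := key (· = s)
  -- The same estimate without a condition on the sum gives the size of the whole family as W with
  -- the same relative error, because the model masses add up to 1.
  have htotal := key fun _ => True
  simp only [Finset.filter_true] at htotal
  rw [sum_prod_modelMass 𝔽 hω (by rw [hcardR]; exact hq0)] at htotal
  rw [measureReal_sum_eq (by omega) hω hX hind h0 h1,
    modelProb_congr (Fintype.equivOfCardEq (by simp [hcard]) : Fin q ≃ 𝔽),
    ncard_filter_cubeFreeFamily hd₁ hd₂, ncard_cubeFreeFamily hd₁ hd₂]
  rw [hcard] at hs htotal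
  have hlow := fifth_le_card_primePairs (𝔽 := 𝔽) hd₁ hd₂ h4
  rw [hcard] at hlow
  have hW := mul_pow_le_three hq4 (d₁ + d₂)
    (sqfreeDensity_le_one (𝔽 := 𝔽) K) (by linarith [eighth_le_meanDensity (𝔽 := 𝔽) h4 K])
    (meanDensity_le_one (𝔽 := 𝔽) K)
  rw [Nat.cast_add] at hW
  have h1r : 0 < 1 - r := by linarith
  have hr0 : 0 < r := by positivity
  obtain ⟨δ, hδ, hδ'⟩ := exists_div_eq_mul_one_add (by positivity) hlow hW (by positivity)
    (Finset.sum_nonneg fun a _ => Finset.prod_nonneg fun x _ => modelMass_nonneg hq0 (a x)) hs htotal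
  refine ⟨δ, hδ.trans ?_, hδ'⟩
  have e1 := hB q hq4 d₂
  have e2 : (q : ℝ) ^ (-(1 - ε') * (d₂ : ℝ) + (q : ℝ)) ≤
      (q : ℝ) ^ (-(1 - ε) * (d₂ : ℝ) + (q : ℝ)) := by
    refine Real.rpow_le_rpow_of_exponent_le (by linarith) ?_
    have : (0 : ℝ) ≤ d₂ := Nat.cast_nonneg _
    nlinarith
  have e3 := sqrt_zpow_eq_rpow q d₁
  rw [← ht] at e3
  rw [e3]
  have e4 := e1.trans (mul_le_mul_of_nonneg_left e2 hC₀)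
  have p1 : 0 < (q : ℝ) ^ (-(1 - ε) * (d₂ : ℝ) + (q : ℝ)) := by positivity
  have p2 : 0 < (q : ℝ) ^ (-((d₁ : ℝ) - 3 * (q : ℝ)) / 2) := by positivity
  nlinarith [mul_nonneg hC₀ p2.le]
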